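/- Let $\mathbb{R}_+=(0,\infty)$ and, for $f\colon\mathbb{R}_+\to\mathbb{R}$, let $\Delta f(x)=f(x+1)-f(x)$. For $p\in\mathbb{N}=\{0,1,2,\ldots\}$ let $\mathcal{C}^p$ be the set of $p$ times continuously differentiable functions $g\colon\mathbb{R}_+\to\mathbb{R}$; let $\mathcal{D}^p$ be the set of functions $g\colon\mathbb{R}_+\to\mathbb{R}$ such that $\Delta^p g(n)\to 0$ as the integer $n$ tends to infinity; and let $\mathcal{K}^p$ be the set of functions $g\colon\mathbb{R}_+\to\mathbb{R}$ that are, on some interval $(a,\infty)$ with $a>0$, either $p$-convex or $p$-concave, i.e., whose divided differences $g[x_0,\ldots,x_{p+1}]$ at points $x_0<\cdots<x_{p+1}$ of $(a,\infty)$ are all $\geq 0$, or all $\leq 0$. For $g\in\mathcal{D}^p\cap\mathcal{K}^p$ the function $\Sigma g\colon\mathbb{R}_+\to\mathbb{R}$ is defined by $$\Sigma g(x)=\lim_{n\to\infty}\left(-g(x)+\sum_{k=1}^{n-1}\bigl(g(k)-g(x+k)\bigr)+\sum_{j=1}^{p}\binom{x}{j}\,\Delta^{j-1}g(n)\right),\qquad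 x>0$$ (the limit exists and does not depend on the choice of $p$), and if $g$ is moreover continuous, its asymptotic constant is $\sigma[g]=\int_0^1\Sigma g(t+1)\,dt$. Let $B_n$ and $B_n(x)$ denote the Bernoulli numbers and the Bernoulli polynomials, and $\{t\}$ the fractional part of $t$. Integrals over $(0,\infty)$ are improper: $\int_0^\infty=\lim_{T\to\infty}\int_0^T$. (a) If $g$ lies in $\mathcal{C}^2\cap\mathcal{D}^1\cap\mathcal{K}^2$, then $\Sigma g$ and $\sigma[g]$ are well defined, and for any $x>0$ the improper integral below converges and $$\Sigma g(x)=\sigma[g]+\int_1^x g(t)\,dt-\frac12\,g(x)+\int_0^\infty\left(\frac12-\{t\}\right)g'(x+t)\,dt.$$ (b) If $g$ lies in $\mathcal{C}^{2q+1}\cap\mathcal{D}^{2q}\cap\mathcal{K}^{2q+1}$ for some integer $q\geq 1$, then $\Sigma g$ and $\sigma[g]$ are well defined, and for any $x>0$ the improper integral below converges and $$\Sigma g(x)=\sigma[g]+\int_1^x g(t)\,dt-\frac12\,g(x)+\sum_{k=1}^q\frac{B_{2k}}{(2k)!}\,g^{(2k-1)}(x)+\int_0^\infty\frac{B_{2q}(\{t\})}{(2q)!}\,g^{(2q)}(x+t)\,dt.$$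 -/

import Mathlib

open Set Filter Topology MeasureTheory

/-!
Functions on the open half-line `(0, ∞)` are represented by functions `ℝ → ℝ`; every notion below
only uses their values on `(0, ∞)`.
-/

namespace LogGammaType

noncomputable section

/-- The divided difference `f[x₀, …, xₙ]` of `f` at pairwise distinct points: the coefficient of
degree `n` of the polynomial of degree at most `n` interpolating `f` at these points. -/
def dividedDifference {n : ℕ} (f : ℝ → ℝ) (x : Fin (n + 1) → ℝ) : ℝ :=
  ∑ k, f (x k) / ∏ j ∈ Finset.univ.erase k, (x k - x j)

/-- `f` is `p`-convex on `I`: `f[x₀, …, x_{p+1}] ≥ 0` for all `x₀ < ⋯ < x_{p+1}` in `I`. -/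
def PConvexOn (p : ℕ) (I : Set ℝ) (f : ℝ → ℝ) : Prop :=
  ∀ x : Fin (p + 1 + 1) → ℝ, StrictMono x → (∀ i, x i ∈ I) → 0 ≤ dividedDifference f x

/-- `f` is `p`-concave on `I`: `f[x₀, …, x_{p+1}] ≤ 0` for all `x₀ < ⋯ < x_{p+1}` in `I`. -/
def PConcaveOn (p : ℕ) (I : Set ℝ) (f : ℝ → ℝ) : Prop :=
  ∀ x : Fin (p + 1 + 1) → ℝ, StrictMono x → (∀ i, x i ∈ I) → dividedDifference f x ≤ 0

/-- The class `𝒦^p` of functions that are eventually `p`-convex or eventually `p`-concave. -/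
def MemK (p : ℕ) (f : ℝ → ℝ) : Prop :=
  (∃ a : ℝ, 0 < a ∧ PConvexOn p (Ioi a) f) ∨ (∃ a : ℝ, 0 < a ∧ PConcaveOn p (Ioi a) f)

/-- The iterated difference `Δ^p f`, where `Δ f (x) = f (x + 1) - f x`. -/
def diffIter (p : ℕ) (f : ℝ → ℝ) : ℝ → ℝ :=
  (fwdDiff (1 : ℝ))^[p] f

/-- The class `𝒟^p`: `Δ^p f (n) → 0` as the integer `n` tends to infinity. (For functions in
`𝒦^p` this is equivalent to the convergence along the reals.) -/
def MemD (p : ℕ) (f : ℝ → ℝ) : Prop :=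
  Tendsto (fun n : ℕ => diffIter p f (n : ℝ)) atTop (𝓝 0)

/-- The binomial coefficient `x (x - 1) ⋯ (x - j + 1) / j!` of a real number `x`. -/
def realChoose (x : ℝ) (j : ℕ) : ℝ :=
  (∏ i ∈ Finset.range j, (x - (i : ℝ))) / (j.factorial : ℝ)

/-- The functions
`f^p_n[g](x) = -g(x) + ∑_{k=1}^{n-1} (g(k) - g(x+k)) + ∑_{j=1}^p (x choose j) Δ^{j-1} g(n)`. -/
def approxSum (p n : ℕ) (g : ℝ → ℝ) (x : ℝ) : ℝ :=
  -g x + ∑ k ∈ Finset.Ico 1 n, (g (k : ℝ) - g (x + (k : ℝ)))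
    + ∑ j ∈ Finset.Icc 1 p, realChoose x j * diffIter (j - 1) g (n : ℝ)

/-- The domain of the map `Σ`: the union over `p` of the sets `𝒟^p ∩ 𝒦^p`. -/
def MemDomSigma (g : ℝ → ℝ) : Prop :=
  ∃ p : ℕ, MemD p g ∧ MemK p g

open Classical in
/-- The principal indefinite sum `Σ g (x) = lim_{n → ∞} f^p_n[g](x)`, for `g ∈ 𝒟^p ∩ 𝒦^p`. The
limit is taken for the least such `p`; see `SigmaWellDefined` for the independence of `p`. -/
def principalSum (g : ℝ → ℝ) (x : ℝ) : ℝ :=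
  if h : MemDomSigma g then limUnder atTop (fun n : ℕ => approxSum (Nat.find h) n g x) else 0

/-- `g` lies in the domain of `Σ`, and for every `p` with `g ∈ 𝒟^p ∩ 𝒦^p` the sequence
`f^p_n[g](x)` does converge to `Σ g (x)`, for every `x > 0`. -/
def SigmaWellDefined (g : ℝ → ℝ) : Prop :=
  MemDomSigma g ∧ ∀ p : ℕ, MemD p g → MemK p g → ∀ x : ℝ, 0 < x →
    Tendsto (fun n : ℕ => approxSum p n g x) atTop (𝓝 (principalSum g x))

/-- The asymptotic constant `σ[g] = ∫_0^1 Σ g (t + 1) dt`. -/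
def asymptoticConstant (g : ℝ → ℝ) : ℝ :=
  ∫ t in (0 : ℝ)..1, principalSum g (t + 1)

/-- The improper integral `∫_a^∞ f(t) dt = lim_{T → ∞} ∫_a^T f(t) dt` converges, with value `L`.
The convergence may be conditional. -/
def HasImproperIntegral (f : ℝ → ℝ) (a L : ℝ) : Prop :=
  (∀ T : ℝ, a ≤ T → IntervalIntegrable f volume a T) ∧
    Tendsto (fun T : ℝ => ∫ t in a..T, f t) atTop (𝓝 L)

end

end LogGammaType

/-! Write r = 1 in case (a) and r = 2q in case (b), and let D k be the k-th derivative of g.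
Eventual (r+1)-convexity or (r+1)-concavity makes D (r+1) eventually monotone. Since Δ^r g(n) → 0,
the mean value theorem for differences then shows that D r tends to zero and that D (r+1) eventually
has constant sign (`MemK.eventually_sign`). Only these two facts are used afterwards;
`IsEulerMaclaurinChain` records them.

Integrating by parts against the bounded periodic Bernoulli kernel, the constant sign bounds the
tails of ∫ B_r({t})/r! · D r (x + t) dt by values of D r (`exists_abs_integral_le`). The improper
integral therefore converges, is continuous in x and tends to zero as x → ∞. Let F be the right-hand
side of the formula without σ[g]. The Euler–Maclaurin formula on [x, x + 1] gives F(x + 1) − F(x) =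
g(x).

Hence the sums defining Σg telescope: f^p_n[g](x) is F(x) − F(1) minus the error at n + x of Newton
interpolation of F at n, …, n + p (`approxSum_eq`). For p ≥ r this error vanishes as n → ∞, because
Newton interpolation reproduces Taylor polynomials of degree at most p and the Taylor remainders of
the pieces of F tend to zero. So Σg = F − F(1).

It remains to see that σ[g] = −F(1), that is ∫_1^2 F = 0. The quantity ∫_n^{n+1} F − ∫_1^n g does
not depend on n, and Euler–Maclaurin of order r + 1 for a primitive of g shows that it tends to zero
(`integral_eulerMaclaurinSum`). -/

namespace LogGammaType

/-! ### Forward differences, divided differences and monotone derivatives -/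

/-- Mean value theorem for iterated forward differences. -/
theorem exists_fwdDiff_iter_eq {h : ℝ} (hh : 0 < h) (n : ℕ) (D : ℕ → ℝ → ℝ)
    (hD : ∀ k < n, ∀ y : ℝ, 0 < y → HasDerivAt (D k) (D (k + 1) y) y) {x : ℝ} (hx : 0 < x) :
    ∃ ξ, x ≤ ξ ∧ ξ ≤ x + n * h ∧ (fwdDiff h)^[n] (D 0) x = h ^ n * D n ξ := by
  induction n generalizing D with
  | zero => exact ⟨x, le_rfl, by simp, by simp⟩
  | succ n ih =>
    obtain ⟨ξ, h1, h2, h3⟩ := ih (fun k y => D k (y + h) - D k y) (fun k hk y hy =>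
      ((hD k (by omega) (y + h) (by positivity)).comp_add_const y h).sub (hD k (by omega) y hy))
    have hξ : 0 < ξ := hx.trans_le h1
    obtain ⟨c, hc, hc'⟩ := exists_hasDerivAt_eq_slope (D n) (D (n + 1)) (lt_add_of_pos_right ξ hh)
      (fun y hy => (hD n (by omega) y (hξ.trans_le hy.1)).continuousAt.continuousWithinAt)
      (fun y hy => hD n (by omega) y (hξ.trans hy.1))
    refine ⟨c, h1.trans hc.1.le, ?_, ?_⟩
    · push_cast
      linarith [hc.2]
    · rw [Function.iterate_succ_apply]
      have : fwdDiff h (D 0) = fun y => D 0 (y + h) - D 0 y := rfl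
      rw [this, h3, hc', add_sub_cancel_left, pow_succ]
      field_simp

theorem fwdDiff_iter_congr {h : ℝ} (hh : 0 ≤ h) {f₁ f₂ : ℝ → ℝ} {x : ℝ}
    (hf : ∀ y, x ≤ y → f₁ y = f₂ y) (n : ℕ) :
    (fwdDiff h)^[n] f₁ x = (fwdDiff h)^[n] f₂ x := by
  simp only [fwdDiff_iter_eq_sum_shift]
  refine Finset.sum_congr rfl fun k _ => ?_
  rw [hf _ (le_add_of_nonneg_right (nsmul_nonneg hh k))]

theorem prod_erase_sub_natCast (n k : ℕ) (hk : k ≤ n) :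
    ∏ j ∈ (Finset.range (n + 1)).erase k, ((k : ℝ) - j) =
      (-1) ^ (n - k) * (k.factorial * (n - k).factorial) := by
  have h1 : (Finset.range (n + 1)).erase k = Finset.range k ∪ Finset.Ico (k + 1) (n + 1) := by
    ext j
    simp only [Finset.mem_erase, Finset.mem_range, Finset.mem_union, Finset.mem_Ico]
    omega
  have h2 : Disjoint (Finset.range k) (Finset.Ico (k + 1) (n + 1)) := by
    rw [Finset.disjoint_left]
    intro j
    simp only [Finset.mem_range, Finset.mem_Ico]
    omega
  have h3 : ∀ k : ℕ, ∏ j ∈ Finset.range k, ((k : ℝ) - j) = k.factorial := by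
    intro k
    rw [← Finset.prod_range_reflect, ← Finset.prod_range_add_one_eq_factorial, Nat.cast_prod]
    refine Finset.prod_congr rfl fun j hj => ?_
    rw [Finset.mem_range] at hj
    rw [Nat.sub_sub, Nat.cast_sub (by omega)]
    push_cast
    ring
  rw [h1, Finset.prod_union h2, h3, Finset.prod_Ico_eq_prod_range,
    ← Finset.prod_range_add_one_eq_factorial (n - k)]
  rw [show n + 1 - (k + 1) = n - k by omega, Nat.cast_prod]
  have h4 : ((-1 : ℝ)) ^ (n - k) = ∏ _j ∈ Finset.range (n - k), (-1 : ℝ) := by simp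
  rw [h4, mul_left_comm, ← Finset.prod_mul_distrib]
  congr 1
  refine Finset.prod_congr rfl fun j _ => ?_
  push_cast
  ring

theorem dividedDifference_equispaced (n : ℕ) (f : ℝ → ℝ) (x : ℝ) {h : ℝ} (hh : h ≠ 0) :
    dividedDifference f (fun i : Fin (n + 1) => x + (i : ℕ) * h) =
      (fwdDiff h)^[n] f x / (n.factorial * h ^ n) := by
  have hprod : ∀ k : Fin (n + 1), ∏ j ∈ Finset.univ.erase k,
      ((x + ((k : ℕ) : ℝ) * h) - (x + ((j : ℕ) : ℝ) * h)) =
      h ^ n * ((-1) ^ (n - (k : ℕ)) * ((k : ℕ).factorial * (n - (k : ℕ)).factorial)) := by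
    intro k
    rw [← prod_erase_sub_natCast n k (by omega)]
    have h1 : ∀ j : Fin (n + 1), (x + ((k : ℕ) : ℝ) * h) - (x + ((j : ℕ) : ℝ) * h) =
        h * (((k : ℕ) : ℝ) - ((j : ℕ) : ℝ)) := fun j => by ring
    simp_rw [h1]
    rw [Finset.prod_mul_distrib, Finset.prod_const, Finset.card_erase_of_mem (Finset.mem_univ k)]
    simp only [Finset.card_univ, Fintype.card_fin, Nat.add_sub_cancel]
    congr 1
    refine Finset.prod_bij (fun j _ => (j : ℕ)) ?_ ?_ ?_ ?_
    · intro j hj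
      simp only [Finset.mem_erase, Finset.mem_univ, and_true, Finset.mem_range] at hj ⊢
      exact ⟨fun e => hj (Fin.ext e), j.2⟩
    · intro i _ j _ e
      exact Fin.ext e
    · intro j hj
      simp only [Finset.mem_erase, Finset.mem_range] at hj
      refine ⟨⟨j, hj.2⟩, ?_, rfl⟩
      simp only [Finset.mem_erase, Finset.mem_univ, and_true]
      exact fun e => hj.1 (congrArg Fin.val e)
    · intro j _
      rfl
  rw [dividedDifference]
  simp_rw [hprod]
  rw [fwdDiff_iter_eq_sum_shift, Finset.sum_div, ← Fin.sum_univ_eq_sum_range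
    (fun k => ((-1 : ℤ) ^ (n - k) * (n.choose k : ℤ)) • f (x + k • h) / (n.factorial * h ^ n))]
  refine Finset.sum_congr rfl fun k _ => ?_
  have hk : (k : ℕ) ≤ n := by omega
  have hc := Nat.choose_mul_factorial_mul_factorial hk
  have hc' : (n.choose k : ℝ) * (k : ℕ).factorial * (n - (k : ℕ)).factorial = n.factorial := by
    exact_mod_cast hc
  have hs : ((-1 : ℝ) ^ (n - (k : ℕ))) * (-1) ^ (n - (k : ℕ)) = 1 := by
    rw [← mul_pow]; simp
  have e1 := (Nat.factorial_pos (k : ℕ)).ne'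
  have e2 := (Nat.factorial_pos (n - (k : ℕ))).ne'
  have e3 := (Nat.factorial_pos n).ne'
  rw [div_eq_div_iff (by positivity) (by positivity), ← hc', zsmul_eq_mul, nsmul_eq_mul]
  push_cast
  linear_combination (-(f (x + (k : ℕ) * h) * h ^ n * (n.choose k) * (k : ℕ).factorial *
    (n - (k : ℕ)).factorial)) * hs

theorem dividedDifference_neg {n : ℕ} (f : ℝ → ℝ) (x : Fin (n + 1) → ℝ) :
    dividedDifference (-f) x = -dividedDifference f x := by
  simp [dividedDifference, neg_div]

theorem PConvexOn.fwdDiff_iter_nonneg {p : ℕ} {a : ℝ} {f : ℝ → ℝ} (hf : PConvexOn p (Ioi a) f)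
    {h x : ℝ} (hh : 0 < h) (hx : a < x) : 0 ≤ (fwdDiff h)^[p + 1] f x := by
  have h1 := hf (fun i => x + (i : ℕ) * h)
    (fun i j hij => by
      have : ((i : ℕ) : ℝ) < (j : ℕ) := by exact_mod_cast hij
      dsimp only
      gcongr)
    (fun i => by
      have : 0 ≤ ((i : ℕ) : ℝ) * h := by positivity
      simp only [mem_Ioi]
      linarith)
  rw [dividedDifference_equispaced (p + 1) f x hh.ne'] at h1
  have h2 : 0 < ((p + 1).factorial : ℝ) * h ^ (p + 1) := by positivity
  have := mul_nonneg h1 h2.le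
  rwa [div_mul_cancel₀ _ h2.ne'] at this

/-- The `p`-th derivative of an eventually `p`-convex function is eventually nondecreasing. -/
theorem PConvexOn.monotoneOn_deriv {p : ℕ} {a : ℝ} (ha : 0 ≤ a) {D : ℕ → ℝ → ℝ}
    (hf : PConvexOn p (Ioi a) (D 0))
    (hD : ∀ k < p, ∀ y : ℝ, 0 < y → HasDerivAt (D k) (D (k + 1) y) y)
    (hc : ContinuousOn (D p) (Ioi 0)) : MonotoneOn (D p) (Ioi a) := by
  intro x hx y hy hxy
  rcases hxy.eq_or_lt with rfl | hxy
  · exact le_rfl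
  have hx0 : 0 < x := ha.trans_lt hx
  have hy0 : 0 < y := ha.trans_lt hy
  -- The step (y − x)/(N + 1) leads from x to y in exactly N + 1 steps. Along them the p-th
  -- differences increase, and divided by the p-th power of the step they converge to D p at both
  -- ends.
  have hh : ∀ N : ℕ, 0 < (y - x) / ((N : ℝ) + 1) := fun N => div_pos (by linarith) (by positivity)
  have hh0 : Tendsto (fun N : ℕ => (y - x) / ((N : ℝ) + 1)) atTop (𝓝 0) :=
    tendsto_const_div_atTop_nhds_zero_nat (y - x) |>.comp (tendsto_add_atTop_nat 1) |>.congr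
      fun N => by simp
  have key : ∀ z : ℝ, 0 < z → Tendsto (fun N : ℕ => (fwdDiff ((y - x) / ((N : ℝ) + 1)))^[p] (D 0) z
      / ((y - x) / ((N : ℝ) + 1)) ^ p) atTop (𝓝 (D p z)) := by
    intro z hz
    choose ξ h1 h2 h3 using fun N : ℕ => exists_fwdDiff_iter_eq (hh N) p D hD hz
    have hξ : Tendsto ξ atTop (𝓝 z) := by
      refine tendsto_of_tendsto_of_tendsto_of_le_of_le tendsto_const_nhds ?_ h1 h2
      simpa using (hh0.const_mul (p : ℝ)).const_add z
    refine ((hc.continuousAt (Ioi_mem_nhds hz)).tendsto.comp hξ).congr fun N => ?_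
    rw [h3, mul_comm, mul_div_assoc, div_self (pow_pos (hh N) p).ne', mul_one]
    rfl
  refine le_of_tendsto_of_tendsto' (key x hx0) (key y hy0) fun N => ?_
  have hpos := hh N
  set h := (y - x) / ((N : ℝ) + 1) with hdef
  refine div_le_div_of_nonneg_right ?_ (by positivity)
  have hstep : ∀ m : ℕ, (fwdDiff h)^[p] (D 0) x ≤ (fwdDiff h)^[p] (D 0) (x + m * h) := by
    intro m
    induction m with
    | zero => simp
    | succ m ih =>
      have hm : 0 ≤ (m : ℝ) * h := by positivity
      have h1 := hf.fwdDiff_iter_nonneg hpos (x := x + m * h) (by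
        have : a < x := hx
        linarith)
      rw [Function.iterate_succ_apply', fwdDiff] at h1
      have h2 : x + ((m + 1 : ℕ) : ℝ) * h = x + m * h + h := by push_cast; ring
      rw [h2]
      linarith
  have h4 := hstep (N + 1)
  have h5 : x + ((N + 1 : ℕ) : ℝ) * h = y := by
    rw [hdef]; push_cast; field_simp; ring
  rwa [h5] at h4

theorem MemK.monotoneOn_or_antitoneOn {p : ℕ} {D : ℕ → ℝ → ℝ} (hf : MemK p (D 0))
    (hD : ∀ k < p, ∀ y : ℝ, 0 < y → HasDerivAt (D k) (D (k + 1) y) y)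
    (hc : ContinuousOn (D p) (Ioi 0)) :
    ∃ a, 0 < a ∧ (MonotoneOn (D p) (Ioi a) ∨ AntitoneOn (D p) (Ioi a)) := by
  rcases hf with ⟨a, ha, hf⟩ | ⟨a, ha, hf⟩
  · exact ⟨a, ha, Or.inl (hf.monotoneOn_deriv ha.le hD hc)⟩
  · refine ⟨a, ha, Or.inr ?_⟩
    have h1 : PConvexOn p (Ioi a) (-D 0) := fun x hx hx' => by
      rw [dividedDifference_neg]
      exact neg_nonneg.2 (hf x hx hx')
    have h2 : MonotoneOn (-D p) (Ioi a) := PConvexOn.monotoneOn_deriv ha.le (D := fun k => -D k)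
      h1 (fun k hk y hy => (hD k hk y hy).neg) hc.neg
    simpa using h2.neg

/-- A function which is eventually monotone and tends to zero along points `ξ n ≥ n` tends to zero at infinity. -/
theorem tendsto_zero_of_monotoneOn {f : ℝ → ℝ} {a : ℝ} (hf : MonotoneOn f (Ioi a)) {ξ : ℕ → ℝ}
    (h1 : ∀ᶠ n : ℕ in atTop, (n : ℝ) ≤ ξ n)
    (h3 : Tendsto (fun n => f (ξ n)) atTop (𝓝 0)) : Tendsto f atTop (𝓝 0) := by
  -- A nondecreasing function stays below its limit along ξ, so beyond ξ M it is trapped between f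
  -- (ξ M) and 0.
  have hle : ∀ y, a < y → f y ≤ 0 := by
    intro y hy
    refine ge_of_tendsto h3 ?_
    filter_upwards [h1, tendsto_natCast_atTop_atTop.eventually_ge_atTop y] with n hn hn'
    exact hf hy (hy.trans_le (hn'.trans hn)) (hn'.trans hn)
  rw [Metric.tendsto_atTop] at h3 ⊢
  intro ε hε
  obtain ⟨N, hN⟩ := h3 ε hε
  obtain ⟨N₁, h1⟩ := eventually_atTop.1 h1
  obtain ⟨N₂, hN₂⟩ := exists_nat_gt a
  set M := max N (max N₁ N₂)
  refine ⟨ξ M, fun y hy => ?_⟩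
  have h5 := hN M (le_max_left _ _)
  have h6 : (N₂ : ℝ) ≤ M := by exact_mod_cast (le_max_right N₁ N₂).trans (le_max_right _ _)
  have h7 : a < ξ M :=
    hN₂.trans_le (h6.trans (h1 M ((le_max_left N₁ N₂).trans (le_max_right _ _))))
  have h8 := hf h7 (h7.trans_le hy) hy
  have h9 := hle y (h7.trans_le hy)
  rw [Real.dist_eq, sub_zero, abs_lt] at h5 ⊢
  exact ⟨by linarith, by linarith⟩

theorem MemD.mono {p q : ℕ} (hpq : p ≤ q) {f : ℝ → ℝ} (hf : MemD p f) : MemD q f := by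
  induction q, hpq using Nat.le_induction with
  | base => exact hf
  | succ q _ ih =>
    have h1 := (ih.comp (tendsto_add_atTop_nat 1)).sub ih
    rw [sub_zero] at h1
    refine h1.congr fun n => ?_
    simp [diffIter, Function.iterate_succ_apply', fwdDiff, -Function.iterate_succ]

theorem MemD.tendsto_zero_of_monotoneOn {p : ℕ} {D : ℕ → ℝ → ℝ} (hf : MemD p (D 0))
    (hD : ∀ k < p, ∀ y : ℝ, 0 < y → HasDerivAt (D k) (D (k + 1) y) y) {a : ℝ}
    (hm : MonotoneOn (D p) (Ioi a) ∨ AntitoneOn (D p) (Ioi a)) :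
    Tendsto (D p) atTop (𝓝 0) := by
  -- The index n = 0 is set aside because derivatives are controlled only on the open half-line.
  have hex : ∀ n : ℕ, ∃ ξ : ℝ, (n : ℝ) ≤ ξ ∧ (0 < n → diffIter p (D 0) n = D p ξ) := by
    intro n
    rcases n.eq_zero_or_pos with rfl | hn
    · exact ⟨0, by simp, fun h => absurd h (lt_irrefl _)⟩
    · obtain ⟨ξ, h1, _, h3⟩ := exists_fwdDiff_iter_eq one_pos p D hD (x := n) (by positivity)
      exact ⟨ξ, h1, fun _ => by rw [diffIter, h3, one_pow, one_mul]⟩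
  choose ξ h1 h2 using hex
  have h3 : Tendsto (fun n => D p (ξ n)) atTop (𝓝 0) :=
    Tendsto.congr' (by filter_upwards [eventually_gt_atTop 0] with n hn using h2 n hn) hf
  rcases hm with hm | hm
  · exact LogGammaType.tendsto_zero_of_monotoneOn hm (Eventually.of_forall h1) h3
  · have := LogGammaType.tendsto_zero_of_monotoneOn (f := -D p) hm.neg (Eventually.of_forall h1)
      (by simpa using h3.neg)
    simpa using this.neg

/-- Membership in `𝒟^r ∩ 𝒦^{r+1}` in terms of derivatives. -/
theorem MemK.eventually_sign {r : ℕ} {D : ℕ → ℝ → ℝ} (hK : MemK (r + 1) (D 0)) (hf : MemD r (D 0))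
    (hD : ∀ k < r + 1, ∀ y : ℝ, 0 < y → HasDerivAt (D k) (D (k + 1) y) y)
    (hc : ContinuousOn (D (r + 1)) (Ioi 0)) :
    Tendsto (D r) atTop (𝓝 0) ∧
      ∃ a, 0 < a ∧ ((∀ y, a < y → 0 ≤ D (r + 1) y) ∨ ∀ y, a < y → D (r + 1) y ≤ 0) := by
  obtain ⟨a, ha, hm⟩ := hK.monotoneOn_or_antitoneOn hD hc
  -- The top derivative comes first: it is monotone with limit zero, hence of constant sign.
  have hlim := (hf.mono r.le_succ).tendsto_zero_of_monotoneOn hD hm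
  have hsign : (∀ y, a < y → 0 ≤ D (r + 1) y) ∨ ∀ y, a < y → D (r + 1) y ≤ 0 := by
    rcases hm with hm | hm
    · refine Or.inr fun y hy => ge_of_tendsto hlim ?_
      filter_upwards [eventually_ge_atTop y] with z hz using hm hy (hy.trans_le hz) hz
    · refine Or.inl fun y hy => le_of_tendsto hlim ?_
      filter_upwards [eventually_ge_atTop y] with z hz using hm hy (hy.trans_le hz) hz
  refine ⟨?_, a, ha, hsign⟩
  have hd : ∀ y ∈ Ioi a, HasDerivAt (D r) (D (r + 1) y) y := fun y hy =>
    hD r r.lt_succ_self y (ha.trans hy)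
  -- The sign of D (r + 1) makes D r monotone, so the same argument applies one level lower.
  refine hf.tendsto_zero_of_monotoneOn (fun k hk => hD k (hk.trans r.lt_succ_self)) (a := a) ?_
  refine hsign.imp (fun h => ?_) fun h => ?_
  · exact monotoneOn_of_hasDerivWithinAt_nonneg (convex_Ioi a)
      (fun y hy => (hd y hy).continuousAt.continuousWithinAt)
      (fun y hy => (hd y (interior_subset hy)).hasDerivWithinAt)
      (fun y hy => h y (interior_subset hy))
  · exact antitoneOn_of_hasDerivWithinAt_nonpos (convex_Ioi a)
      (fun y hy => (hd y hy).continuousAt.continuousWithinAt)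
      (fun y hy => (hd y (interior_subset hy)).hasDerivWithinAt)
      (fun y hy => h y (interior_subset hy))

/-! ### Newton interpolation -/

/-- The error at `n + x` of the Newton interpolation polynomial of `f` at `n, n + 1, …, n + p`. -/
noncomputable def newtonError (p : ℕ) (f : ℝ → ℝ) (n x : ℝ) : ℝ :=
  f (n + x) - ∑ j ∈ Finset.range (p + 1), realChoose x j * diffIter j f n

theorem newtonError_add (p : ℕ) (f₁ f₂ : ℝ → ℝ) (n x : ℝ) :
    newtonError p (f₁ + f₂) n x = newtonError p f₁ n x + newtonError p f₂ n x := by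
  simp only [newtonError, diffIter, fwdDiff_iter_add, Pi.add_apply, mul_add,
    Finset.sum_add_distrib]
  ring

theorem newtonError_const_smul (p : ℕ) (c : ℝ) (f : ℝ → ℝ) (n x : ℝ) :
    newtonError p (c • f) n x = c * newtonError p f n x := by
  simp only [newtonError, diffIter, fwdDiff_iter_const_smul, Pi.smul_apply, smul_eq_mul,
    mul_left_comm _ c, ← Finset.mul_sum]
  ring

theorem newtonError_shift (p : ℕ) (f : ℝ → ℝ) (n x : ℝ) :
    newtonError p f n x = newtonError p (fun y => f (y + n)) 0 x := by
  simp only [newtonError, diffIter, fwdDiff_iter_comp_add, zero_add, add_comm n x]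

theorem realChoose_eq (x : ℝ) (j : ℕ) :
    realChoose x j = (descPochhammer ℝ j).eval x / j.factorial := by
  rw [realChoose, descPochhammer_eval_eq_prod_range]

theorem realChoose_natCast (N j : ℕ) : realChoose N j = N.choose j := by
  rw [realChoose_eq, descPochhammer_eval_eq_descFactorial, Nat.descFactorial_eq_factorial_mul_choose,
    Nat.cast_mul, mul_div_cancel_left₀ _ (by positivity)]

/-- The error is itself a polynomial in x, and the Gregory–Newton formula makes every natural number
a root of it. -/
theorem newtonError_polynomial {p : ℕ} {P : Polynomial ℝ} (hP : P.natDegree ≤ p) (x : ℝ) :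
    newtonError p (fun y => P.eval y) 0 x = 0 := by
  set Q : Polynomial ℝ := P - ∑ j ∈ Finset.range (p + 1),
    Polynomial.C (diffIter j (fun y => P.eval y) 0 / j.factorial) * descPochhammer ℝ j with hQ
  have hQe : ∀ y, Q.eval y = newtonError p (fun y => P.eval y) 0 y := by
    intro y
    simp only [hQ, newtonError, realChoose_eq, Polynomial.eval_sub, Polynomial.eval_finsetSum,
      Polynomial.eval_mul, Polynomial.eval_C, zero_add]
    congr 1
    exact Finset.sum_congr rfl fun j _ => by ring
  have hvan : ∀ j, p < j → diffIter j (fun y => P.eval y) 0 = 0 := fun j hj =>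
    congrFun (Polynomial.fwdDiff_iter_eq_zero_of_degree_lt (hP.trans_lt hj)) 0
  have hroot : ∀ N : ℕ, Q.eval (N : ℝ) = 0 := by
    intro N
    have h1 := shift_eq_sum_fwdDiff_iter (1 : ℝ) (fun y => P.eval y) N 0
    rw [nsmul_one, zero_add] at h1
    -- Gregory–Newton stops at N, the interpolation polynomial at p. Both sums extend to N + p,
    -- since binomials vanish for j > N and differences for j > p.
    have h2 : ∀ M, (∀ j ∈ Finset.range (N + p + 1), j ∉ Finset.range (M + 1) →
        (N.choose j : ℝ) * diffIter j (fun y => P.eval y) 0 = 0) → M ≤ N + p →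
        ∑ j ∈ Finset.range (M + 1), (N.choose j : ℝ) * diffIter j (fun y => P.eval y) 0 =
        ∑ j ∈ Finset.range (N + p + 1), (N.choose j : ℝ) * diffIter j (fun y => P.eval y) 0 :=
      fun M hM hMN => Finset.sum_subset (Finset.range_subset_range.2 (by omega)) hM
    rw [hQe, newtonError, zero_add, h1]
    simp_rw [realChoose_natCast, nsmul_eq_mul]
    change ∑ j ∈ Finset.range (N + 1), (N.choose j : ℝ) * diffIter j (fun y => P.eval y) 0 - _ = 0
    rw [h2 N, h2 p, sub_self]
    · intro j _ hj
      rw [hvan j (by simpa using hj), mul_zero]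
    · omega
    · intro j _ hj
      rw [Nat.choose_eq_zero_of_lt (by simpa using hj), Nat.cast_zero, zero_mul]
    · omega
  have hQ0 : Q = 0 := by
    refine Polynomial.eq_zero_of_infinite_isRoot Q
      ((infinite_range_of_injective (Nat.cast_injective (R := ℝ))).mono ?_)
    rintro _ ⟨N, rfl⟩
    exact hroot N
  rw [← hQe, hQ0, Polynomial.eval_zero]

theorem tendsto_newtonError_of_pointwise {ι : Type*} {l : Filter ι} (p : ℕ) {R : ι → ℝ → ℝ}
    (hR : ∀ y, 0 ≤ y → Tendsto (fun i => R i y) l (𝓝 0)) {x : ℝ} (hx : 0 ≤ x) :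
    Tendsto (fun i => newtonError p (R i) 0 x) l (𝓝 0) := by
  have h1 : ∀ j : ℕ, Tendsto (fun i => diffIter j (R i) 0) l (𝓝 0) := by
    intro j
    simp only [diffIter, fwdDiff_iter_eq_sum_shift]
    have h := tendsto_finsetSum (Finset.range (j + 1)) fun k _ =>
      (hR (0 + k • (1 : ℝ)) (by simp)).const_smul ((-1 : ℤ) ^ (j - k) * (j.choose k : ℤ))
    simpa only [smul_zero, Finset.sum_const_zero] using h
  have h2 := (hR x hx).sub (tendsto_finsetSum (Finset.range (p + 1))
    fun j _ => (h1 j).const_mul (realChoose x j))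
  simpa [newtonError] using h2

/-- Taylor's inequality on `[n, n + y]`. -/
theorem abs_sub_taylor_le {n ε Y : ℝ} (hn : 0 < n) (m : ℕ) (D : ℕ → ℝ → ℝ)
    (hD : ∀ k < m, ∀ y : ℝ, 0 < y → HasDerivAt (D k) (D (k + 1) y) y)
    (hε : ∀ y, n ≤ y → |D m y| ≤ ε) (hY : 0 ≤ Y) :
    ∀ y ∈ Icc 0 Y, |D 0 (y + n) - ∑ j ∈ Finset.range m, D j n / j.factorial * y ^ j| ≤
      ε * Y ^ m := by
  induction m generalizing D with
  | zero =>
    intro y hy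
    simpa using hε (y + n) (by linarith [hy.1])
  | succ m ih =>
    intro y hy
    -- The derivative of the Taylor error of D 0 is the Taylor error of D 1, one order lower. Each
    -- integration costs a factor Y; the factorial is not needed.
    have h1 := ih (fun k => D (k + 1)) (fun k hk => hD (k + 1) (by omega)) hε
    have hε0 : 0 ≤ ε := (abs_nonneg _).trans (hε n le_rfl)
    have hder : ∀ z ∈ Icc 0 Y, HasDerivWithinAt
        (fun z => D 0 (z + n) - ∑ j ∈ Finset.range (m + 1), D j n / j.factorial * z ^ j)
        (D 1 (z + n) - ∑ j ∈ Finset.range m, D (j + 1) n / j.factorial * z ^ j) (Icc 0 Y) z := by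
      intro z hz
      refine HasDerivAt.hasDerivWithinAt ?_
      refine ((hD 0 (by omega) (z + n) (by linarith [hz.1])).comp_add_const z n).sub ?_
      simp_rw [Finset.sum_range_succ' _ m]
      simp only [pow_zero, mul_one]
      refine HasDerivAt.add_const _ ?_
      refine HasDerivAt.fun_sum fun j _ => ?_
      refine ((hasDerivAt_pow (j + 1) z).const_mul (D (j + 1) n / (j + 1).factorial)).congr_deriv ?_
      rw [Nat.factorial_succ]
      push_cast
      field_simp
    have h2 := norm_image_sub_le_of_norm_deriv_le_segment' (C := ε * Y ^ m) hder
      (fun z hz => h1 z ⟨hz.1, hz.2.le⟩) y hy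
    simp only [Real.norm_eq_abs, zero_add] at h2
    rw [Finset.sum_range_succ' (fun j => D j n / (j.factorial : ℝ) * (0 : ℝ) ^ j) m] at h2
    simp only [ne_eq, Nat.add_eq_zero_iff, one_ne_zero, and_false, not_false_eq_true, zero_pow,
      mul_zero, Finset.sum_const_zero, pow_zero, Nat.factorial_zero, Nat.cast_one, div_one,
      mul_one, zero_add, sub_self, sub_zero] at h2
    refine h2.trans ?_
    rw [pow_succ, ← mul_assoc]
    exact mul_le_mul_of_nonneg_left hy.2 (by positivity)

/-- The Taylor polynomial at n has degree below m, hence at most p, and contributes no error. The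
Taylor remainder tends to zero pointwise, and the error at fixed x depends on finitely many of its
values. -/
theorem tendsto_newtonError {m p : ℕ} (hmp : m ≤ p + 1) {D : ℕ → ℝ → ℝ}
    (hD : ∀ k < m, ∀ y : ℝ, 0 < y → HasDerivAt (D k) (D (k + 1) y) y)
    (hlim : Tendsto (D m) atTop (𝓝 0)) {x : ℝ} (hx : 0 ≤ x) :
    Tendsto (fun n : ℕ => newtonError p (D 0) n x) atTop (𝓝 0) := by
  set P : ℕ → Polynomial ℝ := fun n => ∑ j ∈ Finset.range m,
    Polynomial.C (D j n / j.factorial) * Polynomial.X ^ j with hP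
  have hPe : ∀ n y, (P n).eval y = ∑ j ∈ Finset.range m, D j n / j.factorial * y ^ j := by
    intro n y
    simp [hP, Polynomial.eval_finsetSum]
  have hPd : ∀ n, (P n).natDegree ≤ p := fun n =>
    Polynomial.natDegree_sum_le_of_forall_le _ _ fun j hj =>
      (Polynomial.natDegree_C_mul_X_pow_le _ _).trans (by
        rw [Finset.mem_range] at hj
        omega)
  have hR : ∀ y : ℝ, 0 ≤ y →
      Tendsto (fun n : ℕ => D 0 (y + n) - (P n).eval y) atTop (𝓝 0) := by
    intro y hy
    rw [Metric.tendsto_atTop] at hlim ⊢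
    intro ε hε
    obtain ⟨A, hA⟩ := hlim (ε / (y ^ m + 1)) (by positivity)
    obtain ⟨N, hN⟩ := exists_nat_gt (max A 0)
    refine ⟨N, fun n hn => ?_⟩
    have hn' : max A 0 < n := hN.trans_le (by exact_mod_cast hn)
    have h1 := abs_sub_taylor_le ((le_max_right _ _).trans_lt hn') m D hD
      (ε := ε / (y ^ m + 1)) (fun z hz => by
        have := hA z (((le_max_left _ _).trans_lt hn').le.trans hz)
        rw [Real.dist_eq, sub_zero] at this
        exact this.le) hy y ⟨hy, le_rfl⟩
    rw [Real.dist_eq, sub_zero, hPe]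
    refine h1.trans_lt ?_
    rw [div_mul_eq_mul_div, div_lt_iff₀ (by positivity)]
    exact mul_lt_mul_of_pos_left (lt_add_one _) hε
  refine (tendsto_newtonError_of_pointwise p hR hx).congr fun n => ?_
  have h1 : (fun y => D 0 (y + n)) =
      (fun y => D 0 (y + n) - (P n).eval y) + fun y => (P n).eval y := by
    ext y
    simp
  rw [newtonError_shift p (D 0), h1, newtonError_add, newtonError_polynomial (hPd n), add_zero]

/-! ### The Euler–Maclaurin formula -/

/-- The 1-periodic function `B_r({t}) / r!`. -/
noncomputable def bernoulliKernel (r : ℕ) (t : ℝ) : ℝ :=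
  bernoulliFun r (Int.fract t) / r.factorial

theorem bernoulliKernel_natCast (r n : ℕ) :
    bernoulliKernel r n = (bernoulli r : ℝ) / r.factorial := by
  rw [bernoulliKernel, Int.fract_natCast, bernoulliFun_eval_zero]

theorem bernoulliKernel_add_one (r : ℕ) (t : ℝ) :
    bernoulliKernel r (t + 1) = bernoulliKernel r t := by
  rw [bernoulliKernel, Int.fract_add_one, bernoulliKernel]

theorem measurable_bernoulliKernel (r : ℕ) : Measurable (bernoulliKernel r) :=
  ((continuous_bernoulliFun r).measurable.comp measurable_fract).div_const _

theorem exists_abs_bernoulliKernel_le (r : ℕ) : ∃ K, 0 ≤ K ∧ ∀ t, |bernoulliKernel r t| ≤ K := by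
  obtain ⟨C, hC⟩ := isCompact_Icc.exists_bound_of_continuousOn (s := Icc (0 : ℝ) 1)
    ((continuous_bernoulliFun r).div_const (r.factorial : ℝ)).continuousOn
  have h : ∀ t, |bernoulliKernel r t| ≤ C := fun t =>
    hC _ ⟨Int.fract_nonneg t, (Int.fract_lt_one t).le⟩
  exact ⟨C, (abs_nonneg _).trans (h 0), h⟩

theorem continuous_bernoulliKernel {r : ℕ} (hr : r ≠ 1) : Continuous (bernoulliKernel r) :=
  (ContinuousOn.comp_fract'' (continuous_bernoulliFun r).continuousOn
    (bernoulliFun_endpoints_eq_of_ne_one hr).symm).div_const _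

/-- Only the right derivative exists at the integers in general: for r = 0 the kernel B_1({t}) jumps
there, for r = 1 the next one has a corner. Together with continuity this suffices for integration
by parts. -/
theorem hasDerivWithinAt_bernoulliKernel (r : ℕ) (t : ℝ) :
    HasDerivWithinAt (bernoulliKernel (r + 1)) (bernoulliKernel r t) (Ioi t) t := by
  have h1 : HasDerivAt (fun s => bernoulliFun (r + 1) (s - ⌊t⌋) / (r + 1).factorial)
      (bernoulliKernel r t) t := by
    have h2 := ((hasDerivAt_bernoulliFun (r + 1) (t - ⌊t⌋)).comp_sub_const t ⌊t⌋).div_const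
      ((r + 1).factorial : ℝ)
    refine h2.congr_deriv ?_
    rw [bernoulliKernel, Nat.add_sub_cancel, Nat.factorial_succ, Int.self_sub_floor]
    push_cast
    field_simp
  refine h1.hasDerivWithinAt.congr_of_eventuallyEq ?_ ?_
  · have h3 : ∀ᶠ s : ℝ in 𝓝[>] t, s < ⌊t⌋ + 1 :=
      nhdsWithin_le_nhds (Iio_mem_nhds (Int.lt_floor_add_one t))
    filter_upwards [self_mem_nhdsWithin, h3] with s hs hs'
    have : ⌊s⌋ = ⌊t⌋ := Int.floor_eq_iff.2 ⟨(Int.floor_le t).trans (le_of_lt hs), hs'⟩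
    rw [bernoulliKernel, Int.fract, this]
  · rw [bernoulliKernel, Int.fract]

theorem intervalIntegrable_bernoulliKernel (r : ℕ) (a b : ℝ) :
    IntervalIntegrable (bernoulliKernel r) volume a b := by
  obtain ⟨K, _, hK⟩ := exists_abs_bernoulliKernel_le r
  exact (intervalIntegrable_const (c := K)).mono_fun'
    (measurable_bernoulliKernel r).aestronglyMeasurable (Eventually.of_forall hK)

theorem continuousOn_comp_const_add {φ : ℝ → ℝ} (hφ : ContinuousOn φ (Ioi 0)) {x S T : ℝ}
    (hS : 0 < x + S) (hST : S ≤ T) : ContinuousOn (fun t => φ (x + t)) (uIcc S T) := by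
  refine hφ.comp (by fun_prop) fun t ht => ?_
  rw [uIcc_of_le hST] at ht
  have := ht.1
  simp only [mem_Ioi]
  linarith

theorem intervalIntegrable_bernoulliKernel_mul (r : ℕ) {φ : ℝ → ℝ} (hφ : ContinuousOn φ (Ioi 0))
    {x S T : ℝ} (hS : 0 < x + S) (hST : S ≤ T) :
    IntervalIntegrable (fun t => bernoulliKernel r t * φ (x + t)) volume S T :=
  (intervalIntegrable_bernoulliKernel r S T).mul_continuousOn
    (continuousOn_comp_const_add hφ hS hST)

theorem integral_bernoulliKernel_mul {r : ℕ} (hr : r ≠ 0) {φ φ' : ℝ → ℝ}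
    (hφ : ∀ y : ℝ, 0 < y → HasDerivAt φ (φ' y) y) (hc : ContinuousOn φ' (Ioi 0)) {x S T : ℝ}
    (hS : 0 < x + S) (hST : S ≤ T) :
    ∫ t in S..T, bernoulliKernel r t * φ (x + t) =
      bernoulliKernel (r + 1) T * φ (x + T) - bernoulliKernel (r + 1) S * φ (x + S)
        - ∫ t in S..T, bernoulliKernel (r + 1) t * φ' (x + t) := by
  have hcφ : ContinuousOn φ (Ioi 0) := fun y hy => (hφ y hy).continuousAt.continuousWithinAt
  have h := intervalIntegral.integral_mul_deriv_eq_deriv_mul_of_hasDeriv_right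
    (continuousOn_comp_const_add hcφ hS hST)
    (continuous_bernoulliKernel (r := r + 1) (by omega)).continuousOn
    (u' := fun t => φ' (x + t)) (v' := bernoulliKernel r)
    (fun t ht => ((hφ (x + t) (by
      rw [min_eq_left hST] at ht
      linarith [ht.1])).comp_const_add x t).hasDerivWithinAt)
    (fun t _ => hasDerivWithinAt_bernoulliKernel r t)
    (continuousOn_comp_const_add hc hS hST).intervalIntegrable
    (intervalIntegrable_bernoulliKernel r S T)
  simp only [mul_comm (bernoulliKernel _ _)]
  rw [h]

/-- The Euler–Maclaurin formula on an interval of length one. -/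
theorem euler_maclaurin_unit {r : ℕ} (hr : 1 ≤ r) {D : ℕ → ℝ → ℝ}
    (hD : ∀ k < r, ∀ y : ℝ, 0 < y → HasDerivAt (D k) (D (k + 1) y) y)
    (hc : ContinuousOn (D r) (Ioi 0)) {x : ℝ} (hx : 0 < x) :
    D 0 x = (∫ t in (0 : ℝ)..1, D 0 (x + t))
      + ∑ j ∈ Finset.Icc 1 r, (bernoulli j : ℝ) / j.factorial * (D (j - 1) (x + 1) - D (j - 1) x)
      + (-1) ^ (r + 1) * ∫ t in (0 : ℝ)..1, bernoulliKernel r t * D r (x + t) := by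
  have hx0 : 0 < x + 0 := by linarith
  induction r, hr using Nat.le_induction with
  | base =>
    have hc0 : ContinuousOn (D 0) (Ioi 0) := fun y hy =>
      (hD 0 one_pos y hy).continuousAt.continuousWithinAt
    -- The kernel of order 1 is discontinuous at t = 1, so the integration by parts uses the
    -- polynomial t − 1/2, equal to it on the open interval.
    have h1 : ∫ t in (0 : ℝ)..1, bernoulliKernel 1 t * D 1 (x + t) =
        ∫ t in (0 : ℝ)..1, (t - 1 / 2) * D 1 (x + t) := by
      refine intervalIntegral.integral_congr_Ioo_of_le zero_le_one fun t ht => ?_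
      simp [bernoulliKernel, Int.fract_eq_self.2 ⟨ht.1.le, ht.2⟩]
    have h2 := intervalIntegral.integral_mul_deriv_eq_deriv_mul_of_hasDerivAt
      (u := fun t : ℝ => t - 1 / 2) (u' := fun _ => 1) (a := 0) (b := 1)
      (v := fun t => D 0 (x + t)) (v' := fun t => D 1 (x + t))
      (by fun_prop) (continuousOn_comp_const_add hc0 hx0 zero_le_one)
      (fun t _ => (hasDerivAt_id t).sub_const _)
      (fun t ht => (hD 0 one_pos (x + t) (by
        rw [min_eq_left zero_le_one] at ht
        linarith [ht.1])).comp_const_add x t)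
      intervalIntegrable_const
      (continuousOn_comp_const_add hc hx0 zero_le_one).intervalIntegrable
    rw [h1, h2]
    simp
    ring
  | succ r hr ih =>
    have hcr : ContinuousOn (D r) (Ioi 0) := fun y hy =>
      (hD r r.lt_succ_self y hy).continuousAt.continuousWithinAt
    have h1 := ih (fun k hk => hD k (hk.trans r.lt_succ_self)) hcr
    rw [integral_bernoulliKernel_mul (by omega) (hD r r.lt_succ_self) hc hx0 zero_le_one] at h1
    have h2 := bernoulliKernel_natCast (r + 1) 0
    have h3 := bernoulliKernel_natCast (r + 1) 1
    rw [Nat.cast_zero] at h2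
    rw [Nat.cast_one] at h3
    rw [h2, h3, add_zero] at h1
    -- The alternating signs disappear because Bernoulli numbers of odd index at least 3 are zero.
    have h4 : (-1 : ℝ) ^ (r + 1) * (bernoulli (r + 1) : ℝ) = bernoulli (r + 1) := by
      rcases Nat.even_or_odd (r + 1) with he | ho
      · rw [he.neg_one_pow, one_mul]
      · rw [bernoulli_eq_zero_of_odd ho (by omega), Rat.cast_zero, mul_zero]
    rw [Finset.sum_Icc_succ_top (by omega), Nat.add_sub_cancel, h1, pow_succ _ (r + 1)]
    linear_combination ((D r (x + 1) - D r x) / ((r + 1).factorial : ℝ)) * h4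

/-! ### The remainder integral -/

theorem abs_integral_mul_le_of_sign {κ ψ : ℝ → ℝ} {K S T : ℝ} (hK : ∀ t, |κ t| ≤ K)
    (hST : S ≤ T) (hψ : IntervalIntegrable ψ volume S T)
    (hs : (∀ t ∈ Ioc S T, 0 ≤ ψ t) ∨ ∀ t ∈ Ioc S T, ψ t ≤ 0) :
    |∫ t in S..T, κ t * ψ t| ≤ K * |∫ t in S..T, ψ t| := by
  have h1 : |∫ t in S..T, κ t * ψ t| ≤ ∫ t in S..T, K * |ψ t| :=
    intervalIntegral.norm_integral_le_of_norm_le hST (Eventually.of_forall fun t _ => by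
      rw [Real.norm_eq_abs, abs_mul]
      exact mul_le_mul_of_nonneg_right (hK t) (abs_nonneg _)) (hψ.abs.const_mul K)
  refine h1.trans ?_
  rw [intervalIntegral.integral_const_mul]
  refine mul_le_mul_of_nonneg_left ?_ ((abs_nonneg _).trans (hK 0))
  rcases hs with hs | hs
  · rw [intervalIntegral.integral_congr_Ioo_of_le hST (g := ψ)
      fun t ht => abs_of_nonneg (hs t (Ioo_subset_Ioc_self ht))]
    exact le_abs_self _
  · rw [intervalIntegral.integral_congr_Ioo_of_le hST (g := fun t => -ψ t)
      fun t ht => abs_of_nonpos (hs t (Ioo_subset_Ioc_self ht)), intervalIntegral.integral_neg]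
    exact neg_le_abs _

/-- The improper integral `∫_0^∞ B_r({t}) / r! * φ (x + t) dt`. -/
noncomputable def remainder (r : ℕ) (φ : ℝ → ℝ) (x : ℝ) : ℝ :=
  limUnder atTop fun T : ℝ => ∫ t in (0 : ℝ)..T, bernoulliKernel r t * φ (x + t)

section Remainder

variable {r : ℕ} {φ φ' : ℝ → ℝ} {a : ℝ}

/-- After one integration by parts, the constant sign of φ' turns ∫ |φ'| into |φ(x + T) − φ(x + S)|.
This gives conditional convergence without integrability of φ. -/
theorem exists_abs_integral_le (hr : r ≠ 0) (hφ : ∀ y : ℝ, 0 < y → HasDerivAt φ (φ' y) y)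
    (hc : ContinuousOn φ' (Ioi 0)) (ha : 0 < a)
    (hs : (∀ y, a < y → 0 ≤ φ' y) ∨ ∀ y, a < y → φ' y ≤ 0) :
    ∃ K, 0 ≤ K ∧ ∀ x S T, a < x + S → S ≤ T →
      |∫ t in S..T, bernoulliKernel r t * φ (x + t)| ≤ K * (|φ (x + S)| + |φ (x + T)|) := by
  obtain ⟨K, hK0, hK⟩ := exists_abs_bernoulliKernel_le (r + 1)
  refine ⟨2 * K, by positivity, fun x S T hS hST => ?_⟩
  have hS0 : 0 < x + S := ha.trans hS
  have hint := (continuousOn_comp_const_add hc hS0 hST).intervalIntegrable (μ := volume)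
  have h1 : ∫ t in S..T, φ' (x + t) = φ (x + T) - φ (x + S) :=
    intervalIntegral.integral_eq_sub_of_hasDerivAt (f := fun t => φ (x + t)) (fun t ht => by
      rw [uIcc_of_le hST] at ht
      exact (hφ (x + t) (by linarith [ht.1])).comp_const_add x t) hint
  have h2 := abs_integral_mul_le_of_sign hK hST hint
    (hs.imp (fun h t ht => h _ (by linarith [ht.1])) fun h t ht => h _ (by linarith [ht.1]))
  rw [h1] at h2
  rw [integral_bernoulliKernel_mul hr hφ hc hS0 hST]
  have h3 : |bernoulliKernel (r + 1) T * φ (x + T)| ≤ K * |φ (x + T)| := by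
    rw [abs_mul]
    exact mul_le_mul_of_nonneg_right (hK _) (abs_nonneg _)
  have h4 : |bernoulliKernel (r + 1) S * φ (x + S)| ≤ K * |φ (x + S)| := by
    rw [abs_mul]
    exact mul_le_mul_of_nonneg_right (hK _) (abs_nonneg _)
  have h5 := mul_le_mul_of_nonneg_left (abs_sub (φ (x + T)) (φ (x + S))) hK0
  refine (abs_sub _ _).trans ((add_le_add (abs_sub _ _) h2).trans ?_)
  linarith

theorem tendsto_remainder (hr : r ≠ 0) (hφ : ∀ y : ℝ, 0 < y → HasDerivAt φ (φ' y) y)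
    (hc : ContinuousOn φ' (Ioi 0)) (ha : 0 < a)
    (hs : (∀ y, a < y → 0 ≤ φ' y) ∨ ∀ y, a < y → φ' y ≤ 0) (hlim : Tendsto φ atTop (𝓝 0))
    {x : ℝ} (hx : 0 < x) :
    Tendsto (fun T : ℝ => ∫ t in (0 : ℝ)..T, bernoulliKernel r t * φ (x + t)) atTop
      (𝓝 (remainder r φ x)) := by
  obtain ⟨K, hK0, hK⟩ := exists_abs_integral_le (r := r) hr hφ hc ha hs
  have hcφ : ContinuousOn φ (Ioi 0) := fun y hy => (hφ y hy).continuousAt.continuousWithinAt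
  refine CauchySeq.tendsto_limUnder ?_
  rw [Metric.cauchySeq_iff']
  intro ε hε
  rw [Metric.tendsto_atTop] at hlim
  obtain ⟨A, hA⟩ := hlim (ε / (2 * K + 1)) (by positivity)
  refine ⟨max A a, fun T hT => ?_⟩
  have hS0 : 0 < max A a := ha.trans_le (le_max_right _ _)
  have hS : a < x + max A a := by linarith [le_max_right A a]
  have h0 := intervalIntegrable_bernoulliKernel_mul r hcφ (x := x) (by linarith) hS0.le
  have h1 := intervalIntegrable_bernoulliKernel_mul r hcφ (x := x) (by linarith) (hS0.le.trans hT)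
  rw [Real.dist_eq, intervalIntegral.integral_interval_sub_left h1 h0]
  refine (hK x _ _ hS hT).trans_lt ?_
  have h2 := hA (x + max A a) (by linarith [le_max_left A a])
  have h3 := hA (x + T) (by linarith [le_max_left A a])
  rw [Real.dist_eq, sub_zero] at h2 h3
  refine (mul_le_mul_of_nonneg_left (add_le_add h2.le h3.le) hK0).trans_lt ?_
  rw [← add_div, mul_div_assoc', div_lt_iff₀ (by positivity)]
  nlinarith

/-- This is the tail bound with T → ∞. That K is independent of x and S yields both the decay of the
remainder (S = 0) and its continuity, as a locally uniform limit. -/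
theorem exists_abs_remainder_sub_le (hr : r ≠ 0) (hφ : ∀ y : ℝ, 0 < y → HasDerivAt φ (φ' y) y)
    (hc : ContinuousOn φ' (Ioi 0)) (ha : 0 < a)
    (hs : (∀ y, a < y → 0 ≤ φ' y) ∨ ∀ y, a < y → φ' y ≤ 0) (hlim : Tendsto φ atTop (𝓝 0)) :
    ∃ K, 0 ≤ K ∧ ∀ x S, 0 < x → 0 ≤ S → a < x + S →
      |remainder r φ x - ∫ t in (0 : ℝ)..S, bernoulliKernel r t * φ (x + t)| ≤
        K * |φ (x + S)| := by
  obtain ⟨K, hK0, hK⟩ := exists_abs_integral_le (r := r) hr hφ hc ha hs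
  have hcφ : ContinuousOn φ (Ioi 0) := fun y hy => (hφ y hy).continuousAt.continuousWithinAt
  refine ⟨K, hK0, fun x S hx hS hxS => ?_⟩
  have h1 := ((tendsto_remainder hr hφ hc ha hs hlim hx).sub_const
    (∫ t in (0 : ℝ)..S, bernoulliKernel r t * φ (x + t))).abs
  have h2 : Tendsto (fun T => K * (|φ (x + S)| + |φ (x + T)|)) atTop
      (𝓝 (K * (|φ (x + S)| + |0|))) :=
    ((hlim.comp (tendsto_atTop_add_const_left _ x tendsto_id)).abs.const_add _).const_mul K
  rw [abs_zero, add_zero] at h2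
  refine le_of_tendsto_of_tendsto h1 h2 ?_
  filter_upwards [eventually_ge_atTop S] with T hT
  rw [intervalIntegral.integral_interval_sub_left
    (intervalIntegrable_bernoulliKernel_mul r hcφ (by linarith) (hS.trans hT))
    (intervalIntegrable_bernoulliKernel_mul r hcφ (by linarith) hS)]
  exact hK x S T hxS hT

theorem tendsto_remainder_atTop (hr : r ≠ 0) (hφ : ∀ y : ℝ, 0 < y → HasDerivAt φ (φ' y) y)
    (hc : ContinuousOn φ' (Ioi 0)) (ha : 0 < a)
    (hs : (∀ y, a < y → 0 ≤ φ' y) ∨ ∀ y, a < y → φ' y ≤ 0) (hlim : Tendsto φ atTop (𝓝 0)) :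
    Tendsto (remainder r φ) atTop (𝓝 0) := by
  obtain ⟨K, hK0, hK⟩ := exists_abs_remainder_sub_le (r := r) hr hφ hc ha hs hlim
  refine squeeze_zero_norm' ?_ (by simpa using hlim.abs.const_mul K)
  filter_upwards [eventually_gt_atTop a] with x hx
  simpa using hK x 0 (ha.trans hx) le_rfl (by simpa using hx)

theorem continuousOn_integral_bernoulliKernel_mul (hφ : ContinuousOn φ (Ioi 0)) {S : ℝ}
    (hS : 0 ≤ S) :
    ContinuousOn (fun x => ∫ t in (0 : ℝ)..S, bernoulliKernel r t * φ (x + t)) (Ioi 0) := by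
  intro x₀ hx₀
  rw [mem_Ioi] at hx₀
  obtain ⟨K, hK0, hK⟩ := exists_abs_bernoulliKernel_le r
  have hpos : ∀ y ∈ Icc (x₀ / 2) (x₀ + 1 + S), y ∈ Ioi (0 : ℝ) := fun y hy =>
    (half_pos hx₀).trans_le hy.1
  obtain ⟨C, hC⟩ := isCompact_Icc.exists_bound_of_continuousOn (hφ.mono hpos)
  have hnhds : ∀ᶠ x in 𝓝 x₀, x₀ / 2 < x ∧ x < x₀ + 1 :=
    Ioo_mem_nhds (half_lt_self hx₀) (lt_add_one x₀)
  refine (intervalIntegral.continuousAt_of_dominated_interval (bound := fun _ => K * C)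
    ?_ ?_ intervalIntegrable_const ?_).continuousWithinAt
  · filter_upwards [hnhds] with x hx
    have := intervalIntegrable_bernoulliKernel_mul r hφ (x := x) (S := 0) (T := S)
      (by linarith [hx.1]) hS
    rw [uIoc_of_le hS]
    exact this.1.aestronglyMeasurable
  · filter_upwards [hnhds] with x hx
    refine Eventually.of_forall fun t ht => ?_
    rw [uIoc_of_le hS] at ht
    rw [norm_mul]
    exact mul_le_mul (hK t) (hC _ ⟨by linarith [ht.1, hx.1], by linarith [ht.2, hx.2]⟩)
      (norm_nonneg _) hK0
  · refine Eventually.of_forall fun t ht => ?_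
    rw [uIoc_of_le hS] at ht
    have h1 : ContinuousAt φ (x₀ + t) := hφ.continuousAt (Ioi_mem_nhds (by linarith [ht.1]))
    exact continuousAt_const.mul
      (ContinuousAt.comp (f := fun x => x + t) (g := φ) h1 (by fun_prop))

theorem continuousOn_remainder (hr : r ≠ 0) (hφ : ∀ y : ℝ, 0 < y → HasDerivAt φ (φ' y) y)
    (hc : ContinuousOn φ' (Ioi 0)) (ha : 0 < a)
    (hs : (∀ y, a < y → 0 ≤ φ' y) ∨ ∀ y, a < y → φ' y ≤ 0) (hlim : Tendsto φ atTop (𝓝 0)) :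
    ContinuousOn (remainder r φ) (Ioi 0) := by
  obtain ⟨K, hK0, hK⟩ := exists_abs_remainder_sub_le (r := r) hr hφ hc ha hs hlim
  have hcφ : ContinuousOn φ (Ioi 0) := fun y hy => (hφ y hy).continuousAt.continuousWithinAt
  have hu : TendstoUniformlyOn
      (fun (S : ℝ) x => ∫ t in (0 : ℝ)..S, bernoulliKernel r t * φ (x + t))
      (remainder r φ) atTop (Ioi 0) := by
    rw [Metric.tendstoUniformlyOn_iff]
    intro ε hε
    rw [Metric.tendsto_atTop] at hlim
    obtain ⟨A, hA⟩ := hlim (ε / (K + 1)) (by positivity)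
    filter_upwards [eventually_ge_atTop A, eventually_ge_atTop a] with S hSA hSa x hx
    rw [mem_Ioi] at hx
    rw [Real.dist_eq]
    refine (hK x S hx (ha.le.trans hSa) (by linarith)).trans_lt ?_
    have h1 := hA (x + S) (by linarith)
    rw [Real.dist_eq, sub_zero] at h1
    refine (mul_le_mul_of_nonneg_left h1.le hK0).trans_lt ?_
    rw [mul_div_assoc', div_lt_iff₀ (by positivity)]
    nlinarith
  refine hu.continuousOn (Eventually.frequently ?_)
  filter_upwards [eventually_ge_atTop 0] with S hS
  exact continuousOn_integral_bernoulliKernel_mul hcφ hS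

theorem remainder_add_one (hr : r ≠ 0) (hφ : ∀ y : ℝ, 0 < y → HasDerivAt φ (φ' y) y)
    (hc : ContinuousOn φ' (Ioi 0)) (ha : 0 < a)
    (hs : (∀ y, a < y → 0 ≤ φ' y) ∨ ∀ y, a < y → φ' y ≤ 0) (hlim : Tendsto φ atTop (𝓝 0))
    {x : ℝ} (hx : 0 < x) :
    remainder r φ (x + 1) =
      remainder r φ x - ∫ t in (0 : ℝ)..1, bernoulliKernel r t * φ (x + t) := by
  have hcφ : ContinuousOn φ (Ioi 0) := fun y hy => (hφ y hy).continuousAt.continuousWithinAt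
  have h1 := tendsto_remainder hr hφ hc ha hs hlim (x := x + 1) (by linarith)
  have h2 := ((tendsto_remainder hr hφ hc ha hs hlim hx).comp
    (tendsto_atTop_add_const_right _ (1 : ℝ) tendsto_id)).sub_const
    (∫ t in (0 : ℝ)..1, bernoulliKernel r t * φ (x + t))
  refine tendsto_nhds_unique h1 (h2.congr' ?_)
  filter_upwards [eventually_ge_atTop 0] with T hT
  have h3 : ∫ t in (0 : ℝ)..T, bernoulliKernel r t * φ (x + 1 + t) =
      ∫ t in (0 : ℝ)..T, (fun t => bernoulliKernel r t * φ (x + t)) (t + 1) := by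
    refine intervalIntegral.integral_congr fun t _ => ?_
    simp only [bernoulliKernel_add_one]
    ring_nf
  rw [h3, intervalIntegral.integral_comp_add_right (fun t => bernoulliKernel r t * φ (x + t)),
    zero_add]
  exact intervalIntegral.integral_interval_sub_left
    (intervalIntegrable_bernoulliKernel_mul r hcφ (by linarith) (by simp; linarith))
    (intervalIntegrable_bernoulliKernel_mul r hcφ (by linarith) zero_le_one)

end Remainder

/-! ### The principal indefinite sum -/

/-- `D 0, …, D (r + 1)` are the successive derivatives on `(0, ∞)` of a function of class
`C^{r+1}`, where `D r` tends to zero and `D (r + 1)` has eventually a constant sign. -/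
structure IsEulerMaclaurinChain (r : ℕ) (D : ℕ → ℝ → ℝ) : Prop where
  one_le : 1 ≤ r
  hasDerivAt : ∀ k < r + 1, ∀ y : ℝ, 0 < y → HasDerivAt (D k) (D (k + 1) y) y
  continuousOn_top : ContinuousOn (D (r + 1)) (Ioi 0)
  tendsto_zero : Tendsto (D r) atTop (𝓝 0)
  exists_sign : ∃ a, 0 < a ∧ ((∀ y, a < y → 0 ≤ D (r + 1) y) ∨ ∀ y, a < y → D (r + 1) y ≤ 0)

/-- Prepend the primitive vanishing at `1` to a sequence of successive derivatives. -/
noncomputable def prependPrimitive (D : ℕ → ℝ → ℝ) : ℕ → ℝ → ℝ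
  | 0 => fun x => ∫ t in (1 : ℝ)..x, D 0 t
  | k + 1 => D k

/-- The right-hand side of the Euler–Maclaurin formula, without the asymptotic constant. -/
noncomputable def eulerMaclaurinSum (r : ℕ) (D : ℕ → ℝ → ℝ) (x : ℝ) : ℝ :=
  (∫ t in (1 : ℝ)..x, D 0 t) + ∑ j ∈ Finset.Icc 1 r, (bernoulli j : ℝ) / j.factorial * D (j - 1) x
    + (-1) ^ r * remainder r (D r) x

/-- The integrals over `[n, n + 1]` of a function tending to zero at infinity tend to zero. -/
theorem tendsto_integral_unit {k f : ℝ → ℝ} {K : ℝ} (hk : ∀ t, |k t| ≤ K)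
    (hf : Tendsto f atTop (𝓝 0)) :
    Tendsto (fun n : ℕ => ∫ t in (0 : ℝ)..1, k t * f (n + t)) atTop (𝓝 0) := by
  have hK0 : 0 ≤ K := (abs_nonneg _).trans (hk 0)
  rw [Metric.tendsto_atTop] at hf ⊢
  intro ε hε
  obtain ⟨A, hA⟩ := hf (ε / (K + 1)) (by positivity)
  obtain ⟨N, hN⟩ := exists_nat_gt A
  refine ⟨N, fun n hn => ?_⟩
  have hn' : A < n := hN.trans_le (by exact_mod_cast hn)
  rw [dist_zero_right]
  have h1 : ‖∫ t in (0 : ℝ)..1, k t * f (n + t)‖ ≤ K * (ε / (K + 1)) * |(1 : ℝ) - 0| := by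
    refine intervalIntegral.norm_integral_le_of_norm_le_const fun t ht => ?_
    rw [uIoc_of_le zero_le_one] at ht
    have h2 := hA (n + t) (by linarith [ht.1])
    rw [dist_zero_right] at h2
    rw [norm_mul]
    exact mul_le_mul (hk t) h2.le (norm_nonneg _) hK0
  refine h1.trans_lt ?_
  rw [sub_zero, abs_one, mul_one, mul_div_assoc', div_lt_iff₀ (by positivity)]
  nlinarith

namespace IsEulerMaclaurinChain

variable {r : ℕ} {D : ℕ → ℝ → ℝ}

theorem continuousOn (h : IsEulerMaclaurinChain r D) {k : ℕ} (hk : k ≤ r + 1) :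
    ContinuousOn (D k) (Ioi 0) := by
  rcases hk.eq_or_lt with rfl | hk
  · exact h.continuousOn_top
  · exact fun y hy => (h.hasDerivAt k hk y hy).continuousAt.continuousWithinAt

theorem intervalIntegrable (h : IsEulerMaclaurinChain r D) {k : ℕ} (hk : k ≤ r + 1) {x y : ℝ}
    (hx : 0 < x) (hy : 0 < y) : IntervalIntegrable (D k) volume x y :=
  ((h.continuousOn hk).mono fun _ ht => (lt_min hx hy).trans_le ht.1).intervalIntegrable

theorem ne_zero (h : IsEulerMaclaurinChain r D) : r ≠ 0 := by
  have := h.one_le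
  omega

theorem hasDerivAt_primitive (h : IsEulerMaclaurinChain r D) {y : ℝ} (hy : 0 < y) :
    HasDerivAt (fun x => ∫ t in (1 : ℝ)..x, D 0 t) (D 0 y) y := by
  have hc := h.continuousOn (Nat.zero_le _)
  exact intervalIntegral.integral_hasDerivAt_right (h.intervalIntegrable (Nat.zero_le _) one_pos hy)
    (hc.stronglyMeasurableAtFilter isOpen_Ioi y hy) (hc.continuousAt (Ioi_mem_nhds hy))

theorem hasDerivAt_prependPrimitive (h : IsEulerMaclaurinChain r D) :
    ∀ k < r + 1 + 1, ∀ y : ℝ, 0 < y →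
      HasDerivAt (prependPrimitive D k) (prependPrimitive D (k + 1) y) y
  | 0, _, _, hy => h.hasDerivAt_primitive hy
  | k + 1, hk, y, hy => h.hasDerivAt k (by omega) y hy

theorem tendsto_remainder (h : IsEulerMaclaurinChain r D) {x : ℝ} (hx : 0 < x) :
    Tendsto (fun T : ℝ => ∫ t in (0 : ℝ)..T, bernoulliKernel r t * D r (x + t)) atTop
      (𝓝 (remainder r (D r) x)) := by
  obtain ⟨a, ha, hs⟩ := h.exists_sign
  exact LogGammaType.tendsto_remainder h.ne_zero (h.hasDerivAt r r.lt_succ_self)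
    h.continuousOn_top ha hs h.tendsto_zero hx

theorem tendsto_remainder_atTop (h : IsEulerMaclaurinChain r D) :
    Tendsto (remainder r (D r)) atTop (𝓝 0) := by
  obtain ⟨a, ha, hs⟩ := h.exists_sign
  exact LogGammaType.tendsto_remainder_atTop h.ne_zero (h.hasDerivAt r r.lt_succ_self)
    h.continuousOn_top ha hs h.tendsto_zero

theorem continuousOn_remainder (h : IsEulerMaclaurinChain r D) :
    ContinuousOn (remainder r (D r)) (Ioi 0) := by
  obtain ⟨a, ha, hs⟩ := h.exists_sign
  exact LogGammaType.continuousOn_remainder h.ne_zero (h.hasDerivAt r r.lt_succ_self)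
    h.continuousOn_top ha hs h.tendsto_zero

theorem hasImproperIntegral_remainder (h : IsEulerMaclaurinChain r D) {x : ℝ} (hx : 0 < x) :
    HasImproperIntegral (fun t => bernoulliKernel r t * D r (x + t)) 0 (remainder r (D r) x) :=
  ⟨fun _ hT => intervalIntegrable_bernoulliKernel_mul r (h.continuousOn r.le_succ)
    (by linarith) hT, h.tendsto_remainder hx⟩

theorem eulerMaclaurinSum_add_one (h : IsEulerMaclaurinChain r D) {x : ℝ} (hx : 0 < x) :
    eulerMaclaurinSum r D (x + 1) = eulerMaclaurinSum r D x + D 0 x := by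
  obtain ⟨a, ha, hs⟩ := h.exists_sign
  have h1 := euler_maclaurin_unit h.one_le (fun k hk => h.hasDerivAt k (hk.trans r.lt_succ_self))
    (h.continuousOn r.le_succ) hx
  have h2 := remainder_add_one h.ne_zero (h.hasDerivAt r r.lt_succ_self)
    h.continuousOn_top ha hs h.tendsto_zero hx
  have h3 : ∫ t in (0 : ℝ)..1, D 0 (x + t) = ∫ t in x..x + 1, D 0 t := by
    rw [intervalIntegral.integral_comp_add_left, add_zero]
  have h4 := intervalIntegral.integral_add_adjacent_intervals
    (h.intervalIntegrable (Nat.zero_le _) one_pos hx)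
    (h.intervalIntegrable (Nat.zero_le _) hx (by linarith : 0 < x + 1))
  simp only [mul_sub, Finset.sum_sub_distrib] at h1
  rw [eulerMaclaurinSum, eulerMaclaurinSum, h2, ← h4, h1, h3]
  ring

theorem continuousOn_eulerMaclaurinSum (h : IsEulerMaclaurinChain r D) :
    ContinuousOn (eulerMaclaurinSum r D) (Ioi 0) := by
  refine ContinuousOn.add (ContinuousOn.add ?_ ?_) (h.continuousOn_remainder.const_mul _)
  · exact fun y hy => (h.hasDerivAt_primitive hy).continuousAt.continuousWithinAt
  · refine continuousOn_finsetSum _ fun j hj => (h.continuousOn ?_).const_mul _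
    rw [Finset.mem_Icc] at hj
    omega

theorem tendsto_newtonError_eulerMaclaurinSum (h : IsEulerMaclaurinChain r D) {p : ℕ} (hp : r ≤ p)
    {x : ℝ} (hx : 0 ≤ x) :
    Tendsto (fun n : ℕ => newtonError p (eulerMaclaurinSum r D) n x) atTop (𝓝 0) := by
  have hF : eulerMaclaurinSum r D = prependPrimitive D 0 +
      ∑ j ∈ Finset.Icc 1 r, ((bernoulli j : ℝ) / j.factorial) • D (j - 1) +
      ((-1 : ℝ) ^ r) • remainder r (D r) := by
    ext y
    simp [eulerMaclaurinSum, prependPrimitive]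
  have hsum : ∀ (s : Finset ℕ) (c : ℕ → ℝ) (n : ℝ),
      newtonError p (∑ j ∈ s, c j • D (j - 1)) n x =
        ∑ j ∈ s, c j * newtonError p (D (j - 1)) n x := by
    intro s c n
    induction s using Finset.induction_on with
    | empty => simpa using newtonError_const_smul p 0 0 n x
    | insert j s hj ih =>
      rw [Finset.sum_insert hj, Finset.sum_insert hj, newtonError_add, newtonError_const_smul, ih]
  -- The primitive needs r + 1 derivatives to reach D r, whence the requirement r ≤ p.
  have h1 := tendsto_newtonError (p := p) (m := r + 1) (by omega)
    (fun k hk => h.hasDerivAt_prependPrimitive k (hk.trans (r + 1).lt_succ_self))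
    h.tendsto_zero hx
  have h2 : ∀ j ∈ Finset.Icc 1 r,
      Tendsto (fun n : ℕ => newtonError p (D (j - 1)) n x) atTop (𝓝 0) := by
    intro j hj
    rw [Finset.mem_Icc] at hj
    refine tendsto_newtonError (p := p) (m := r - (j - 1)) (D := fun k => D (j - 1 + k)) (by omega)
      (fun k hk => h.hasDerivAt (j - 1 + k) (by omega)) ?_ hx
    rw [show j - 1 + (r - (j - 1)) = r by omega]
    exact h.tendsto_zero
  -- No derivative of the remainder is needed: it tends to zero itself.
  have h3 := tendsto_newtonError (p := p) (m := 0) (D := fun _ => remainder r (D r)) (by omega)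
    (fun k hk => absurd hk k.not_lt_zero) h.tendsto_remainder_atTop hx
  have h4 := (h1.add (tendsto_finsetSum _ fun j hj =>
    (h2 j hj).const_mul ((bernoulli j : ℝ) / j.factorial))).add (h3.const_mul ((-1 : ℝ) ^ r))
  simp only [mul_zero, Finset.sum_const_zero, add_zero] at h4
  refine h4.congr fun n => ?_
  rw [hF, newtonError_add, newtonError_add, hsum, newtonError_const_smul]

/-! ### Convergence of the approximating sums -/

theorem approxSum_eq (h : IsEulerMaclaurinChain r D) (p : ℕ) {n : ℕ} (hn : 1 ≤ n) {x : ℝ}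
    (hx : 0 < x) :
    approxSum p n (D 0) x = eulerMaclaurinSum r D x - eulerMaclaurinSum r D 1
      - newtonError p (eulerMaclaurinSum r D) n x := by
  set F := eulerMaclaurinSum r D with hF
  have hstep : ∀ y, 0 < y → F (y + 1) = F y + D 0 y := fun y hy => h.eulerMaclaurinSum_add_one hy
  have h1 : ∑ k ∈ Finset.Ico 1 n, (D 0 k - D 0 (x + k)) =
      F n - F 1 - F (x + n) + F (x + 1) := by
    induction n, hn using Nat.le_induction with
    | base => simp
    | succ n hn ih =>
      have hn0 : (0 : ℝ) < n := by exact_mod_cast hn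
      rw [Finset.sum_Ico_succ_top hn, ih]
      push_cast
      rw [← add_assoc, hstep n hn0, hstep (x + n) (by positivity)]
      ring
  have hn0 : (0 : ℝ) < n := by exact_mod_cast hn
  have h2 : ∀ j, diffIter (j + 1) F n = diffIter j (D 0) n := by
    intro j
    rw [diffIter, Function.iterate_succ_apply]
    refine fwdDiff_iter_congr zero_le_one (fun y hy => ?_) j
    rw [fwdDiff, hstep y (hn0.trans_le hy)]
    ring
  have h3 : ∑ j ∈ Finset.Icc 1 p, realChoose x j * diffIter (j - 1) (D 0) n =
      ∑ j ∈ Finset.range p, realChoose x (j + 1) * diffIter (j + 1) F n := by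
    rw [Finset.range_eq_Ico, Finset.sum_Ico_add' (fun j => realChoose x j * diffIter j F n)]
    refine Finset.sum_congr (by ext; simp) fun j hj => ?_
    obtain ⟨i, rfl⟩ := Nat.exists_eq_succ_of_ne_zero (n := j) (by
      rw [Finset.mem_Ico] at hj
      omega)
    rw [Nat.succ_sub_one, h2]
  rw [approxSum, h1, h3, newtonError, Finset.sum_range_succ', add_comm (n : ℝ) x, hstep x hx]
  simp [realChoose, diffIter]
  ring

theorem tendsto_approxSum_of_le (h : IsEulerMaclaurinChain r D) {p : ℕ} (hp : r ≤ p) {x : ℝ}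
    (hx : 0 < x) : Tendsto (fun n : ℕ => approxSum p n (D 0) x) atTop
      (𝓝 (eulerMaclaurinSum r D x - eulerMaclaurinSum r D 1)) := by
  have h1 := (h.tendsto_newtonError_eulerMaclaurinSum hp hx.le).const_sub
    (eulerMaclaurinSum r D x - eulerMaclaurinSum r D 1)
  rw [sub_zero] at h1
  refine h1.congr' ?_
  filter_upwards [eventually_ge_atTop 1] with n hn
  rw [h.approxSum_eq p hn hx]

/-- The least admissible p in the definition of `principalSum` may be smaller than r. Passing from p
to `max r p` adds only terms with differences of order at least p, which tend to zero. -/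
theorem tendsto_approxSum (h : IsEulerMaclaurinChain r D) {p : ℕ} (hf : MemD p (D 0)) {x : ℝ}
    (hx : 0 < x) : Tendsto (fun n : ℕ => approxSum p n (D 0) x) atTop
      (𝓝 (eulerMaclaurinSum r D x - eulerMaclaurinSum r D 1)) := by
  have h1 := h.tendsto_approxSum_of_le (le_max_left r p) hx
  have h2 : Tendsto (fun n : ℕ => ∑ j ∈ Finset.Ioc p (max r p),
      realChoose x j * diffIter (j - 1) (D 0) n) atTop (𝓝 0) := by
    have := tendsto_finsetSum (Finset.Ioc p (max r p)) fun j hj =>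
      (hf.mono (q := j - 1) (by
        rw [Finset.mem_Ioc] at hj
        omega)).const_mul (realChoose x j)
    simpa only [mul_zero, Finset.sum_const_zero] using this
  have h3 := h1.sub h2
  rw [sub_zero] at h3
  refine h3.congr fun n => ?_
  have h4 : Finset.Icc 1 (max r p) = Finset.Icc 1 p ∪ Finset.Ioc p (max r p) := by
    ext j
    simp only [Finset.mem_Icc, Finset.mem_union, Finset.mem_Ioc]
    omega
  have h5 : Disjoint (Finset.Icc 1 p) (Finset.Ioc p (max r p)) := by
    rw [Finset.disjoint_left]
    intro j
    simp only [Finset.mem_Icc, Finset.mem_Ioc]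
    omega
  rw [approxSum, approxSum, h4, Finset.sum_union h5]
  ring

theorem principalSum_eq (h : IsEulerMaclaurinChain r D) (hdom : MemDomSigma (D 0)) {x : ℝ}
    (hx : 0 < x) :
    principalSum (D 0) x = eulerMaclaurinSum r D x - eulerMaclaurinSum r D 1 := by
  classical
  rw [principalSum, dif_pos hdom]
  refine Tendsto.limUnder_eq (h.tendsto_approxSum ?_ hx)
  convert (Nat.find_spec hdom).1

theorem sigmaWellDefined (h : IsEulerMaclaurinChain r D) (hdom : MemDomSigma (D 0)) :
    SigmaWellDefined (D 0) := by
  refine ⟨hdom, fun p hp _ x hx => ?_⟩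
  rw [h.principalSum_eq hdom hx]
  exact h.tendsto_approxSum hp hx

/-! ### Value of the asymptotic constant -/

theorem intervalIntegrable_eulerMaclaurinSum (h : IsEulerMaclaurinChain r D) {x y : ℝ}
    (hx : 0 < x) (hy : 0 < y) : IntervalIntegrable (eulerMaclaurinSum r D) volume x y :=
  (h.continuousOn_eulerMaclaurinSum.mono fun _ ht =>
    (lt_min hx hy).trans_le ht.1).intervalIntegrable

theorem integral_eulerMaclaurinSum_natCast (h : IsEulerMaclaurinChain r D) {n : ℕ} (hn : 1 ≤ n) :
    ∫ t in (n : ℝ)..n + 1, eulerMaclaurinSum r D t =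
      (∫ t in (1 : ℝ)..2, eulerMaclaurinSum r D t) + ∫ t in (1 : ℝ)..n, D 0 t := by
  induction n, hn using Nat.le_induction with
  | base => norm_num
  | succ n hn ih =>
    have hn0 : (0 : ℝ) < n := by exact_mod_cast hn
    have hn1 : (0 : ℝ) < (n : ℝ) + 1 := by positivity
    push_cast
    rw [← intervalIntegral.integral_comp_add_right (eulerMaclaurinSum r D) (1 : ℝ),
      intervalIntegral.integral_congr (g := fun t => eulerMaclaurinSum r D t + D 0 t),
      intervalIntegral.integral_add (h.intervalIntegrable_eulerMaclaurinSum hn0 hn1)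
        (h.intervalIntegrable (Nat.zero_le _) hn0 hn1), ih, add_assoc,
      intervalIntegral.integral_add_adjacent_intervals
        (h.intervalIntegrable (Nat.zero_le _) one_pos hn0)
        (h.intervalIntegrable (Nat.zero_le _) hn0 hn1)]
    intro t ht
    exact h.eulerMaclaurinSum_add_one ((lt_min hn0 hn1).trans_le ht.1)

/-- Euler–Maclaurin of order r + 1 for the primitive of g: its boundary terms are the integrals over
[x, x + 1] of the terms of F, except the last, which leaves ∫ D r. The factors `1 *` fit
`tendsto_integral_unit`. -/
theorem integral_eulerMaclaurinSum_sub (h : IsEulerMaclaurinChain r D) {x : ℝ} (hx : 0 < x) :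
    (∫ t in x..x + 1, eulerMaclaurinSum r D t) - ∫ t in (1 : ℝ)..x, D 0 t =
      (-1) ^ r * (∫ t in (0 : ℝ)..1, 1 * remainder r (D r) (x + t))
      - (bernoulli (r + 1) : ℝ) / (r + 1).factorial * (∫ t in (0 : ℝ)..1, 1 * D r (x + t))
      - (-1) ^ r * ∫ t in (0 : ℝ)..1, bernoulliKernel (r + 1) t * D r (x + t) := by
  have hx1 : 0 < x + 1 := by linarith
  have hder : ∀ k ≤ r, prependPrimitive D k (x + 1) - prependPrimitive D k x =
      ∫ t in x..x + 1, D k t := fun k hk => by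
    refine (intervalIntegral.integral_eq_sub_of_hasDerivAt (fun t ht => ?_)
      (h.intervalIntegrable (by omega) hx hx1)).symm
    exact h.hasDerivAt_prependPrimitive k (by omega) t ((lt_min hx hx1).trans_le ht.1)
  have h1 := euler_maclaurin_unit (r := r + 1) (by omega)
    (fun k hk => h.hasDerivAt_prependPrimitive k (by omega)) (h.continuousOn r.le_succ) hx
  have hprim : ContinuousOn (prependPrimitive D 0) (Ioi 0) := fun y hy =>
    (h.hasDerivAt_primitive hy).continuousAt.continuousWithinAt
  have hint : ∀ f : ℝ → ℝ, ContinuousOn f (Ioi 0) → IntervalIntegrable f volume x (x + 1) :=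
    fun f hf => (hf.mono fun _ ht => (lt_min hx hx1).trans_le ht.1).intervalIntegrable
  have hterm : ∀ j ∈ Finset.Icc 1 r, IntervalIntegrable
      (fun t => (bernoulli j : ℝ) / j.factorial * D (j - 1) t) volume x (x + 1) := fun j hj =>
    (h.intervalIntegrable (by rw [Finset.mem_Icc] at hj; omega) hx hx1).const_mul _
  have hsum : IntervalIntegrable (fun t => ∑ j ∈ Finset.Icc 1 r,
      (bernoulli j : ℝ) / j.factorial * D (j - 1) t) volume x (x + 1) :=
    (IntervalIntegrable.sum _ hterm).congr fun t _ => by simp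
  have h2 : ∫ t in x..x + 1, eulerMaclaurinSum r D t =
      (∫ t in x..x + 1, prependPrimitive D 0 t) + ∑ j ∈ Finset.Icc 1 r,
        (bernoulli j : ℝ) / j.factorial * (∫ t in x..x + 1, D (j - 1) t)
      + (-1) ^ r * ∫ t in x..x + 1, remainder r (D r) t := by
    simp only [← intervalIntegral.integral_const_mul]
    rw [← intervalIntegral.integral_finsetSum hterm, ← intervalIntegral.integral_add,
      ← intervalIntegral.integral_add]
    · rfl
    · exact (hint _ hprim).add hsum
    · exact (hint _ h.continuousOn_remainder).const_mul _
    · exact hint _ hprim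
    · exact hsum
  have hshift : ∀ f : ℝ → ℝ, ∫ t in (0 : ℝ)..1, f (x + t) = ∫ t in x..x + 1, f t := fun f => by
    rw [intervalIntegral.integral_comp_add_left, add_zero]
  have h3 : ∑ j ∈ Finset.Icc 1 r, (bernoulli j : ℝ) / j.factorial *
      (prependPrimitive D (j - 1) (x + 1) - prependPrimitive D (j - 1) x) =
      ∑ j ∈ Finset.Icc 1 r, (bernoulli j : ℝ) / j.factorial * ∫ t in x..x + 1, D (j - 1) t :=
    Finset.sum_congr rfl fun j hj => by
      rw [hder]
      rw [Finset.mem_Icc] at hj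
      omega
  rw [Finset.sum_Icc_succ_top (by omega), h3, Nat.add_sub_cancel, hder r le_rfl, hshift] at h1
  change (∫ t in (1 : ℝ)..x, D 0 t) = _ + _ + _ * ∫ t in (0 : ℝ)..1, _ * D r (x + t) at h1
  simp only [one_mul]
  rw [h2, h1, hshift, hshift, pow_succ, pow_succ]
  ring

/-- The Euler–Maclaurin sum has mean value zero on `[1, 2]`. -/
theorem integral_eulerMaclaurinSum (h : IsEulerMaclaurinChain r D) :
    ∫ t in (1 : ℝ)..2, eulerMaclaurinSum r D t = 0 := by
  obtain ⟨K, _, hK⟩ := exists_abs_bernoulliKernel_le (r + 1)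
  have hone : ∀ t : ℝ, |(fun _ => (1 : ℝ)) t| ≤ 1 := fun t => by simp
  have h1 := (((tendsto_integral_unit hone h.tendsto_remainder_atTop).const_mul ((-1 : ℝ) ^ r)).sub
    ((tendsto_integral_unit hone h.tendsto_zero).const_mul
      ((bernoulli (r + 1) : ℝ) / (r + 1).factorial))).sub
    ((tendsto_integral_unit hK h.tendsto_zero).const_mul ((-1 : ℝ) ^ r))
  simp only [mul_zero, sub_zero] at h1
  -- For n ≥ 1 the vanishing expression equals the constant ∫_1^2 F.
  refine tendsto_nhds_unique (tendsto_const_nhds.congr' ?_) h1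
  filter_upwards [eventually_ge_atTop 1] with n hn
  have hn0 : (0 : ℝ) < n := by exact_mod_cast hn
  rw [← h.integral_eulerMaclaurinSum_sub hn0, h.integral_eulerMaclaurinSum_natCast hn]
  ring

theorem intervalIntegrable_principalSum (h : IsEulerMaclaurinChain r D)
    (hdom : MemDomSigma (D 0)) :
    IntervalIntegrable (fun t : ℝ => principalSum (D 0) (t + 1)) volume 0 1 := by
  refine ContinuousOn.intervalIntegrable ?_
  have h1 : ContinuousOn (fun t => eulerMaclaurinSum r D (t + 1) - eulerMaclaurinSum r D 1)
      (uIcc 0 1) := by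
    refine (h.continuousOn_eulerMaclaurinSum.comp (by fun_prop) fun t ht => ?_).sub
      continuousOn_const
    rw [uIcc_of_le zero_le_one] at ht
    exact add_pos_of_nonneg_of_pos ht.1 one_pos
  refine h1.congr fun t ht => ?_
  rw [uIcc_of_le zero_le_one] at ht
  exact h.principalSum_eq hdom (add_pos_of_nonneg_of_pos ht.1 one_pos)

theorem asymptoticConstant_eq (h : IsEulerMaclaurinChain r D) (hdom : MemDomSigma (D 0)) :
    asymptoticConstant (D 0) = -eulerMaclaurinSum r D 1 := by
  have h1 : asymptoticConstant (D 0) =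
      ∫ t in (0 : ℝ)..1, (fun t => eulerMaclaurinSum r D t - eulerMaclaurinSum r D 1) (t + 1) := by
    refine intervalIntegral.integral_congr fun t ht => ?_
    rw [uIcc_of_le zero_le_one] at ht
    exact h.principalSum_eq hdom (add_pos_of_nonneg_of_pos ht.1 one_pos)
  rw [h1, intervalIntegral.integral_comp_add_right
    (fun t => eulerMaclaurinSum r D t - eulerMaclaurinSum r D 1), intervalIntegral.integral_sub
    (h.intervalIntegrable_eulerMaclaurinSum (by norm_num) (by norm_num)) (by simp), zero_add,
    one_add_one_eq_two, h.integral_eulerMaclaurinSum]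
  simp
  norm_num

theorem principalSum_eq_asymptoticConstant_add (h : IsEulerMaclaurinChain r D)
    (hdom : MemDomSigma (D 0)) {x : ℝ} (hx : 0 < x) :
    principalSum (D 0) x = asymptoticConstant (D 0) + eulerMaclaurinSum r D x := by
  rw [h.principalSum_eq hdom hx, h.asymptoticConstant_eq hdom]
  ring

end IsEulerMaclaurinChain

/-! ### From the function classes to the two formulas -/

theorem isEulerMaclaurinChain_iteratedDeriv {r : ℕ} (hr : 1 ≤ r) {g : ℝ → ℝ}
    (hg : ContDiffOn ℝ ((r + 1 : ℕ) : WithTop ℕ∞) g (Ioi 0)) (hD : MemD r g)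
    (hK : MemK (r + 1) g) : IsEulerMaclaurinChain r fun k => iteratedDeriv k g := by
  have heq : ∀ k, EqOn (iteratedDerivWithin k g (Ioi 0)) (iteratedDeriv k g) (Ioi 0) :=
    fun k => iteratedDerivWithin_of_isOpen isOpen_Ioi
  have hder : ∀ k < r + 1, ∀ y : ℝ, 0 < y →
      HasDerivAt (iteratedDeriv k g) (iteratedDeriv (k + 1) g y) y := by
    intro k hk y hy
    have h1 : DifferentiableAt ℝ (iteratedDeriv k g) y :=
      (((hg.differentiableOn_iteratedDerivWithin (by exact_mod_cast hk)
        isOpen_Ioi.uniqueDiffOn).congr fun z hz => (heq k hz).symm) y hy).differentiableAt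
        (Ioi_mem_nhds hy)
    rw [iteratedDeriv_succ]
    exact h1.hasDerivAt
  have hc : ContinuousOn (iteratedDeriv (r + 1) g) (Ioi 0) :=
    (hg.continuousOn_iteratedDerivWithin le_rfl isOpen_Ioi.uniqueDiffOn).congr
      fun z hz => (heq (r + 1) hz).symm
  have h0 : iteratedDeriv 0 g = g := iteratedDeriv_zero
  obtain ⟨h1, h2⟩ := MemK.eventually_sign (D := fun k => iteratedDeriv k g) (by rwa [h0])
    (by rwa [h0]) hder hc
  exact ⟨hr, hder, hc, h1, h2⟩

theorem sum_bernoulli_even (q : ℕ) (hq : 1 ≤ q) (D : ℕ → ℝ) :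
    ∑ j ∈ Finset.Icc 1 (2 * q), (bernoulli j : ℝ) / j.factorial * D (j - 1) =
      -(1 / 2) * D 0 + ∑ k ∈ Finset.Icc 1 q,
        (bernoulli (2 * k) : ℝ) / (2 * k).factorial * D (2 * k - 1) := by
  induction q, hq using Nat.le_induction with
  | base =>
    rw [show 2 * 1 = 1 + 1 from rfl, Finset.sum_Icc_succ_top (by omega)]
    simp
    ring
  | succ q hq ih =>
    rw [show 2 * (q + 1) = 2 * q + 1 + 1 by ring, Finset.sum_Icc_succ_top (by omega),
      Finset.sum_Icc_succ_top (by omega), ih, Finset.sum_Icc_succ_top (by omega),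
      bernoulli_eq_zero_of_odd ⟨q, rfl⟩ (by omega), show 2 * (q + 1) = 2 * q + 1 + 1 by ring]
    simp
    ring

end LogGammaType

theorem proposition8 (g : ℝ → ℝ) :
    ((ContDiffOn ℝ 2 g (Ioi 0) ∧ LogGammaType.MemD 1 g ∧ LogGammaType.MemK 2 g) →
      LogGammaType.SigmaWellDefined g ∧
      IntervalIntegrable (fun t : ℝ => LogGammaType.principalSum g (t + 1)) volume 0 1 ∧
      ∀ x : ℝ, 0 < x → ∃ L : ℝ,
        LogGammaType.HasImproperIntegral
          (fun t : ℝ => (1 / 2 - Int.fract t) * deriv g (x + t)) 0 L ∧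
        LogGammaType.principalSum g x =
          LogGammaType.asymptoticConstant g + (∫ t in (1 : ℝ)..x, g t) - 1 / 2 * g x + L) ∧
    (∀ q : ℕ, 1 ≤ q →
      (ContDiffOn ℝ ((2 * q + 1 : ℕ) : WithTop ℕ∞) g (Ioi 0) ∧
        LogGammaType.MemD (2 * q) g ∧ LogGammaType.MemK (2 * q + 1) g) →
      LogGammaType.SigmaWellDefined g ∧
      IntervalIntegrable (fun t : ℝ => LogGammaType.principalSum g (t + 1)) volume 0 1 ∧
      ∀ x : ℝ, 0 < x → ∃ L : ℝ,
        LogGammaType.HasImproperIntegral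
          (fun t : ℝ => bernoulliFun (2 * q) (Int.fract t) / ((2 * q).factorial : ℝ)
            * iteratedDeriv (2 * q) g (x + t)) 0 L ∧
        LogGammaType.principalSum g x =
          LogGammaType.asymptoticConstant g + (∫ t in (1 : ℝ)..x, g t) - 1 / 2 * g x
            + (∑ k ∈ Finset.Icc 1 q, ((bernoulli (2 * k) : ℚ) : ℝ) / ((2 * k).factorial : ℝ)
                * iteratedDeriv (2 * k - 1) g x)
            + L) := by
  have h0 : iteratedDeriv 0 g = g := iteratedDeriv_zero
  constructor
  · rintro ⟨hg, hD, hK⟩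
    have h := LogGammaType.isEulerMaclaurinChain_iteratedDeriv le_rfl (by exact_mod_cast hg) hD hK
    -- The domain asks for equal indices in 𝒟 and 𝒦, so the 𝒟 index is raised by one.
    have hdom : LogGammaType.MemDomSigma g := ⟨2, hD.mono one_le_two, hK⟩
    have hdom' : LogGammaType.MemDomSigma (iteratedDeriv 0 g) := by rwa [h0]
    have h1 := h.sigmaWellDefined hdom'
    have h2 := h.intervalIntegrable_principalSum hdom'
    have h3 := fun x hx => h.principalSum_eq_asymptoticConstant_add hdom' (x := x) hx
    simp only [h0] at h1 h2 h3
    -- The kernel of order 1 is {t} − 1/2, opposite to the one in (a); the factor (−1)^1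
    -- compensates.
    refine ⟨h1, h2, fun x hx => ⟨-LogGammaType.remainder 1 (iteratedDeriv 1 g) x, ?_, ?_⟩⟩
    · obtain ⟨h4, h5⟩ := h.hasImproperIntegral_remainder hx
      have h6 : (fun t : ℝ => (1 / 2 - Int.fract t) * deriv g (x + t)) =
          fun t => -(LogGammaType.bernoulliKernel 1 t * iteratedDeriv 1 g (x + t)) := by
        ext t
        simp [LogGammaType.bernoulliKernel, iteratedDeriv_one]
        ring
      rw [h6]
      refine ⟨fun T hT => (h4 T hT).neg, ?_⟩
      simp only [intervalIntegral.integral_neg]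
      exact h5.neg
    · rw [h3 x hx]
      simp [LogGammaType.eulerMaclaurinSum]
      ring
  · rintro q hq ⟨hg, hD, hK⟩
    have h := LogGammaType.isEulerMaclaurinChain_iteratedDeriv (by omega) hg hD hK
    have hdom : LogGammaType.MemDomSigma g := ⟨2 * q + 1, hD.mono (Nat.le_succ _), hK⟩
    have hdom' : LogGammaType.MemDomSigma (iteratedDeriv 0 g) := by rwa [h0]
    have h1 := h.sigmaWellDefined hdom'
    have h2 := h.intervalIntegrable_principalSum hdom'
    have h3 := fun x hx => h.principalSum_eq_asymptoticConstant_add hdom' (x := x) hx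
    simp only [h0] at h1 h2 h3
    refine ⟨h1, h2, fun x hx => ⟨LogGammaType.remainder (2 * q) (iteratedDeriv (2 * q) g) x,
      h.hasImproperIntegral_remainder hx, ?_⟩⟩
    rw [h3 x hx, LogGammaType.eulerMaclaurinSum, LogGammaType.sum_bernoulli_even q hq fun k => iteratedDeriv k g x,
      (even_two_mul q).neg_one_pow]
    simp only [iteratedDeriv_zero]
    ring
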